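/- **Setting.** Fix $L\ge 1$ and parameters $p_i\in[0,1)$, $q_{ij}\in[0,1]$ ($1\le i,j\le L$) with $\prod_{\ell=1}^L(1-q_{\ell j})<1$ for every $j$. Station indices are cyclic, so $L+1$ is read as $1$. The customer classes are $\mathcal K=\{(i,j): 1\le i\le L,\ 0\le j\le L\}$, and $\|\cdot\|$ is the $L^1$-norm. **Markov chain.** $X^2$ is the discrete-time Markov chain of the multiclass ring network, with state space $\mathcal S^2=(\mathbb Z_+\times\{v\in\{0,1\}^L:\sum_k v_k\le1\})^L$; a state records the number $Q_{ij}$ of class-$(i,j)$ customers. With independent random variables $U_{ij}(t)$, uniform on $(0,1)$, its one-step dynamics are, for $1\le i,j\le L$, $$Q_{i0}(t+1)=Q_{i0}(t)-\mathbf 1\{Q_{i0}(t)>0\}\mathbf 1\{\textstyle\sum_{\ell=1}^L Q_{i\ell}(t)=0\}+\mathbf 1\{U_{i0}(t)\le p_i\},$$ $$Q_{i+1,j}(t+1)=\delta_{ij}\mathbf 1\{Q_{i0}(t)>0\}\mathbf 1\{\textstyle\sum_{\ell=1}^L Q_{i\ell}(t)=0\}+Q_{ij}(t)\mathbf 1\{U_{ij}(t)>q_{ij}\}.$$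 **Fluid model.** Let $P$ be the matrix on $\mathcal K$ with $P_{i0,\,(i+1)i}=1$, $P_{ij,\,(i+1)j}=1-q_{ij}$ for $j\ne0$, and all other entries $0$. Let $p\in\mathbb R^{\mathcal K}$ have entries $p_{i0}=p_i$ and $p_{ij}=0$ for $j\neq0$. A fluid model solution is a pair of functions $\bar Q,\bar T:[0,\infty)\to\mathbb R^{\mathcal K}$ such that - $\bar Q(t)=\bar Q(0)+pt-(I-P^\top)\bar T(t)$ for all $t\ge0$; - $\bar Q\ge0$, and each component of $\bar Q$ is $1$-Lipschitz; - $\bar T$ is nondecreasing, $\bar T(0)=0$, and each component of $\bar T$ is $1$-Lipschitz; - $\bar I_i(t):=t-\sum_{j=0}^L\bar T_{ij}(t)$ is nondecreasing, and $\int_0^\infty\bar Q_{i0}(t)\,d\bar I_i(t)=0$, for every $i$; - $\bar Q_{ij}\equiv0$ for all $i,j\in\{1,\dots,L\}$. The fluid model is *stable* if there is a $\delta>0$, depending only on the parameters, such that every fluid model solution with $\|\bar Q(0)\|=1$ satisfies $\bar Q(t)=0$ for all $t\ge\delta$. **Proposition.** If the fluid model is stable, then the Markov chain $X^2$ is positive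 recurrent, in the following sense. Let $\mathcal R\subseteq\mathcal S^2$ be the set of states that can be reached with positive probability from the empty state. Then for every initial state $x\in\mathcal S^2$ and every $y\in\mathcal R$, $\mathbb E_x[\tau_y]<\infty$, where $\tau_y=\inf\{n\ge1: X^2(n)=y\}$. (In particular $X^2$ is irreducible and positive recurrent on $\mathcal R$, and $\mathcal R$ is reached in finite expected time from every state.) -/

import Mathlib

open MeasureTheory
open scoped ENNReal NNReal Matrix

noncomputable section

namespace RingNetwork

/-- A parameter setting for a ring with `L` stations. Stations are `0, …, L - 1`, and station
`i + 1` (cyclic addition in `Fin L`) follows station `i`. At each time step a customer arrives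
from outside at station `i` with probability `p i`; a type-`j` customer served at station `i`
leaves with probability `q i j`. Every type of customer leaves somewhere on the ring. -/
structure Params (L : ℕ) where
  p : Fin L → ℝ
  q : Fin L → Fin L → ℝ
  p_nonneg : ∀ i, 0 ≤ p i
  p_lt_one : ∀ i, p i < 1
  q_nonneg : ∀ i j, 0 ≤ q i j
  q_le_one : ∀ i j, q i j ≤ 1
  prod_lt_one : ∀ j, ∏ l, (1 - q l j) < 1

/-- Customer classes: `(i, none)` is the class `(i, 0)` of external arrivals at station `i`,
and `(i, some j)` is the class `(i, j)` of type-`j` customers at station `i`. -/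
abbrev Class (L : ℕ) : Type := Fin L × Option (Fin L)

/-! ### The multiclass network as a Markov chain -/

/-- The set `{v ∈ {0,1}^L : ∑ v_j ≤ 1}` (natural numbers with sum at most one are `0` or `1`). -/
abbrev RingState (L : ℕ) : Type := {v : Fin L → ℕ // ∑ j, v j ≤ 1}

/-- The state space `(ℤ₊ × {v ∈ {0,1}^L : ∑ v_j ≤ 1})^L`: at station `i`, `(x i).1` is the number
of class `(i, 0)` customers and `(x i).2.1 j` the number of class `(i, j)` customers. -/
abbrev State (L : ℕ) : Type := Fin L → ℕ × RingState L

/-- The state in which there are no customers. -/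
def emptyState (L : ℕ) : State L := fun _ => (0, ⟨fun _ => 0, by simp⟩)

/-- Station `i` serves a class `(i, 0)` customer: there is one, and no customer of a class
`(i, j)`, `j ≠ 0`, which would have priority. -/
def ServesExternal {L : ℕ} (x : State L) (i : Fin L) : Prop :=
  0 < (x i).1 ∧ ∑ j, (x i).2.1 j = 0

open Classical in
/-- The number of class `(i + 1, j)` customers after one step in terms of the state of station `i`:
a class `(i, 0)` customer that is served becomes a class `(i + 1, i)` customer, and a class
`(i, j)` customer becomes a class `(i + 1, j)` customer if `u (i, j) > q i j`, and leaves
otherwise. -/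
def transfer {L : ℕ} (θ : Params L) (x : State L) (u : Class L → ℝ) (i j : Fin L) : ℕ :=
  (if i = j ∧ ServesExternal x i then 1 else 0)
    + (if θ.q i j < u (i, some j) then (x i).2.1 j else 0)

theorem sum_transfer_le {L : ℕ} (θ : Params L) (x : State L) (u : Class L → ℝ) (i : Fin L) :
    ∑ j, transfer θ x u i j ≤ 1 := by
  classical
  by_cases h : ServesExternal x i
  · have h0 : ∀ j, (x i).2.1 j = 0 := by
      intro j
      exact (Finset.sum_eq_zero_iff.mp h.2) j (Finset.mem_univ j)
    simp [transfer, h, h0]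
  · refine le_trans (Finset.sum_le_sum fun j _ => ?_) (x i).2.2
    simp only [transfer, h, and_false, if_false, zero_add]
    split_ifs <;> simp

open Classical in
/-- One step of the network from state `x`, driven by numbers `u (i, j) ∈ (0,1)`: one class
`(i, 0)` customer is removed if served and one is added if `u (i, 0) ≤ p i`; the other classes
are updated by `transfer` from the preceding station. -/
def step {L : ℕ} [NeZero L] (θ : Params L) (x : State L) (u : Class L → ℝ) : State L := fun i =>
  ((x i).1 - (if ServesExternal x i then 1 else 0) + (if u (i, none) ≤ θ.p i then 1 else 0),
    ⟨transfer θ x u (i - 1), sum_transfer_le θ x u (i - 1)⟩)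

/-- The uniform distribution on `(0,1)`. -/
def unif : Measure ℝ := volume.restrict (Set.Ioo 0 1)

instance : IsProbabilityMeasure unif := ⟨by simp [unif]⟩

/-- The sample space: a vector of numbers indexed by the customer classes for each time step. -/
abbrev Ω (L : ℕ) : Type := ℕ → Class L → ℝ

/-- The law under which all driving numbers are independent and uniform on `(0,1)`. -/
def noise (L : ℕ) : Measure (Ω L) :=
  Measure.infinitePi fun _ : ℕ => Measure.pi fun _ : Class L => unif

instance (L : ℕ) : IsProbabilityMeasure (noise L) := by
  unfold noise; infer_instance

/-- The Markov chain of the multiclass network, started from the state `x`. -/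
def chain {L : ℕ} [NeZero L] (θ : Params L) (x : State L) : ℕ → Ω L → State L
  | 0, _ => x
  | t + 1, ω => step θ (chain θ x t ω) (ω t)

/-- The first time `n ≥ 1` at which the chain started from `x` is in the state `y`
(`∞` if there is none). -/
def returnTime {L : ℕ} [NeZero L] (θ : Params L) (x y : State L) (ω : Ω L) : ℝ≥0∞ :=
  ⨅ (n : ℕ) (_ : 1 ≤ n ∧ chain θ x n ω = y), (n : ℝ≥0∞)

/-- The state `y` can be reached from the state `x` with positive probability. -/
def Accessible {L : ℕ} [NeZero L] (θ : Params L) (x y : State L) : Prop :=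
  ∃ n, 0 < noise L {ω | chain θ x n ω = y}

/-- Positive recurrence of the chain, whose essential states are those accessible from the empty
state: from every initial state, the expected time to reach (or return to) any essential state
is finite. With `x = y` this says that every essential state is positive recurrent; with `x`
and `y` essential it contains irreducibility on the set of essential states; and it says that
this set is reached in finite expected time from the other states. -/
def PositiveRecurrent {L : ℕ} [NeZero L] (θ : Params L) : Prop :=
  ∀ x y : State L, Accessible θ (emptyState L) y → ∫⁻ ω, returnTime θ x y ω ∂(noise L) < ∞

/-! ### The fluid model -/

/-- The routing matrix: the probability that a customer of the first class becomes a customer of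
the second class on completion of its service. -/
def routing {L : ℕ} [NeZero L] (θ : Params L) : Matrix (Class L) (Class L) ℝ
  | (i, none), (k, l) => if k = i + 1 ∧ l = some i then 1 else 0
  | (i, some j), (k, l) => if k = i + 1 ∧ l = some j then 1 - θ.q i j else 0

/-- The vector of exogenous arrival rates. -/
def arrivalRate {L : ℕ} (θ : Params L) : Class L → ℝ
  | (i, none) => θ.p i
  | (_, some _) => 0

/-- The incidence matrix of stations and the customer classes served there. -/
def incidence (L : ℕ) : Matrix (Fin L) (Class L) ℝ := fun i k => if k.1 = i then 1 else 0

/-- The cumulative idle time `e t - C T(t)` of the stations. -/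
def idle {L : ℕ} (T : ℝ≥0 → Class L → ℝ) (t : ℝ≥0) : Fin L → ℝ :=
  (fun _ => (t : ℝ)) - incidence L *ᵥ T t

/-- The idle time of station `i` as a function on the real line, constant on `(-∞, 0]`. -/
def idleExt {L : ℕ} (T : ℝ≥0 → Class L → ℝ) (i : Fin L) (t : ℝ) : ℝ := idle T t.toNNReal i

theorem monotone_idleExt {L : ℕ} {T : ℝ≥0 → Class L → ℝ} (h : Monotone (idle T)) (i : Fin L) :
    Monotone (idleExt T i) := fun _ _ hst => h (Real.toNNReal_mono hst) i

/-- `(Q, T)` is a solution of the fluid model equations. The integral in `work_conserving` is the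
Lebesgue–Stieltjes integral over `[0, ∞)` of the nonnegative function `Q_{i0}` with respect to the
nondecreasing function `I_i`. -/
structure IsFluidSolution {L : ℕ} [NeZero L] (θ : Params L) (Q T : ℝ≥0 → Class L → ℝ) : Prop where
  balance : ∀ t : ℝ≥0,
    Q t = Q 0 + (t : ℝ) • arrivalRate θ - (1 - (routing θ)ᵀ) *ᵥ T t
  Q_nonneg : ∀ t, 0 ≤ Q t
  Q_lipschitz : ∀ k, LipschitzWith 1 fun t => Q t k
  T_mono : Monotone T
  T_lipschitz : ∀ k, LipschitzWith 1 fun t => T t k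
  T_zero : T 0 = 0
  idle_mono : Monotone (idle T)
  work_conserving : ∀ i,
    ∫⁻ t in Set.Ici (0 : ℝ), ENNReal.ofReal (Q t.toNNReal (i, none))
      ∂(monotone_idleExt idle_mono i).stieltjesFunction.measure = 0
  priority : ∀ t i j, Q t (i, some j) = 0

/-- Stability of the fluid model: there is `δ > 0`, depending only on the parameters, such that
every fluid model solution with `L¹`-norm one at time zero vanishes from time `δ` on. -/
def FluidStable {L : ℕ} [NeZero L] (θ : Params L) : Prop :=
  ∃ δ : ℝ≥0, 0 < δ ∧ ∀ Q T : ℝ≥0 → Class L → ℝ, IsFluidSolution θ Q T →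
    ∑ k, |Q 0 k| = 1 → ∀ t, δ ≤ t → Q t = 0

end RingNetwork

end

noncomputable section

namespace RingNetwork

/-! ### The Markov property -/

/-! The argument is the fluid limit method: a Foster–Lyapunov bound whose drift comes from stability
of the fluid model.

Every chain, whatever its initial state, is driven by the same noise, so one sample point can be
followed along a sequence of initial states `x n` with `total (x n) → ∞`. Scale time and space by
`total (x n)`. The queue lengths satisfy the fluid balance equation up to a martingale
(`queue_chain`), whose variance grows at most linearly in time. If `total (x n) ≥ 2 ^ n`, the scaled
variances are summable and the martingale term vanishes almost surely
(`ae_tendsto_scaled_deviation`). Bounded increments give Lipschitz limits along every ultrafilter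
(`exists_lipschitz_limit`). These limits solve the fluid model with initial norm one, hence vanish
at time `δ` (`tendsto_total_of_fluidStable`). Dominated convergence turns this into a drift bound:
from any state `x` with enough customers, the mean number of customers is at most halved after `⌊δ *
total x⌋` steps (`exists_forall_integral_total_le`).

Since the number of steps depends on the state, the drift criterion needed is
`lintegral_returnTime_lt_top_of_drift`. It also requires the target to be accessible from the finite
exceptional set. This holds because with positive probability the network receives no arrivals until
it has emptied (`exists_potential`, `exists_noise_chain_pos`). -/

/-- The sequence with first term `z.1` and remaining terms `z.2`. -/
def prepend {α : Type*} (z : α × (ℕ → α)) : ℕ → α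
  | 0 => z.1
  | n + 1 => z.2 n

theorem measurable_prepend {α : Type*} [MeasurableSpace α] : Measurable (prepend (α := α)) := by
  refine measurable_pi_lambda _ fun n => ?_
  cases n with
  | zero => exact measurable_fst
  | succ n => exact (measurable_pi_apply n).comp measurable_snd

/-- An infinite product measure is determined by its finite boxes. Padding the index set of a box to
an initial segment of `ℕ`, with full factors at the new indices, lets the first coordinate split
off. -/
theorem measurePreserving_prepend {α : Type*} [MeasurableSpace α] (μ : Measure α)
    [IsProbabilityMeasure μ] :
    MeasurePreserving prepend (μ.prod (Measure.infinitePi fun _ : ℕ => μ))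
      (Measure.infinitePi fun _ : ℕ => μ) := by
  classical
  refine ⟨measurable_prepend, Measure.eq_infinitePi _ fun s t ht => ?_⟩
  obtain ⟨N, hN⟩ := s.exists_nat_subset_range
  set t' : ℕ → Set α := fun i => if i ∈ s then t i else Set.univ with ht'
  have mt' : ∀ i, MeasurableSet (t' i) := fun i => by
    simp only [ht']; split_ifs
    exacts [ht i, .univ]
  have hset : prepend ⁻¹' (Set.pi (s : Set ℕ) t)
      = t' 0 ×ˢ (Set.pi (Finset.range N : Set ℕ) fun i => t' (i + 1)) := by
    ext ⟨u, ω⟩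
    simp only [Set.mem_preimage, Set.mem_pi, Finset.mem_coe, Set.mem_prod, ht', Finset.mem_range]
    constructor
    · intro h
      refine ⟨?_, fun i _ => ?_⟩
      · split_ifs with h0
        exacts [h 0 h0, trivial]
      · split_ifs with h0
        exacts [h _ h0, trivial]
    · rintro ⟨h0, h1⟩ i hi
      cases i with
      | zero => simpa [hi, prepend] using h0
      | succ i =>
        have := Finset.mem_range.mp (hN hi)
        simpa [hi, prepend] using h1 i (by omega)
  rw [Measure.map_apply measurable_prepend (.pi s.countable_toSet fun i _ => ht i), hset,
    Measure.prod_prod, Measure.infinitePi_pi _ fun i _ => mt' _, mul_comm,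
    ← Finset.prod_range_succ' fun i => μ (t' i)]
  rw [← Finset.prod_subset (hN.trans (Finset.range_subset_range.mpr N.le_succ))]
  · exact Finset.prod_congr rfl fun i hi => by simp [ht', hi]
  · intro i _ hi
    simp [ht', hi]

/-- The law of the numbers that drive one step. -/
abbrev stepLaw (L : ℕ) : Measure (Class L → ℝ) := Measure.pi fun _ => unif

theorem lintegral_noise_eq {L : ℕ} {f : Ω L → ℝ≥0∞} (hf : Measurable f) :
    ∫⁻ ω, f ω ∂(noise L) = ∫⁻ u, ∫⁻ ω, f (prepend (u, ω)) ∂(noise L) ∂(stepLaw L) := by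
  rw [noise, ← (measurePreserving_prepend (stepLaw L)).lintegral_comp hf]
  exact lintegral_prod _ (hf.comp measurable_prepend).aemeasurable

theorem integral_noise_eq {L : ℕ} {f : Ω L → ℝ} (hf : Measurable f) {C : ℝ} (hC : ∀ ω, |f ω| ≤ C) :
    ∫ ω, f ω ∂(noise L) = ∫ u, ∫ ω, f (prepend (u, ω)) ∂(noise L) ∂(stepLaw L) := by
  have h := (measurePreserving_prepend (stepLaw L)).integrable_comp_of_integrable
    (g := f) (Integrable.of_bound (C := C) hf.aestronglyMeasurable (.of_forall hC))
  rw [noise, ← (measurePreserving_prepend (stepLaw L)).map_eq,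
    integral_map measurable_prepend.aemeasurable hf.aestronglyMeasurable,
    (measurePreserving_prepend (stepLaw L)).map_eq]
  exact integral_prod _ h

section

variable {L : ℕ} [NeZero L] (θ : Params L)

/-- The Markov property at time one. With `lintegral_noise_eq` and `integral_noise_eq` it lets later
moment estimates go by induction on the first step, uniformly in the initial state, without
conditional expectations. -/
theorem chain_prepend (x : State L) (t : ℕ) (z : (Class L → ℝ) × Ω L) :
    chain θ x (t + 1) (prepend z) = chain θ (step θ x z.1) t z.2 := by
  induction t with
  | zero => rfl
  | succ t ih =>
    change step θ (chain θ x (t + 1) (prepend z)) _ = step θ (chain θ _ t z.2) _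
    rw [ih]; rfl

theorem measurable_step (x : State L) : Measurable (step θ x) := by
  refine measurable_pi_lambda _ fun i => Measurable.prodMk ?_ (Measurable.subtype_mk ?_)
  · refine measurable_const.add (Measurable.ite ?_ measurable_const measurable_const)
    exact measurableSet_le (measurable_pi_apply _) measurable_const
  · refine measurable_pi_lambda _ fun j => ?_
    refine measurable_const.add (Measurable.ite ?_ measurable_const measurable_const)
    exact measurableSet_lt measurable_const (measurable_pi_apply _)

theorem measurable_chain (x : State L) (t : ℕ) : Measurable (chain θ x t) := by
  induction t with
  | zero => exact measurable_const
  | succ t ih =>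
    have h : Measurable fun z : State L × (Class L → ℝ) => step θ z.1 z.2 :=
      measurable_from_prod_countable_right fun x => measurable_step θ x
    exact h.comp (ih.prodMk (measurable_pi_apply t))

theorem lintegral_chain_succ (x : State L) (t : ℕ) (f : State L → ℝ≥0∞) :
    ∫⁻ ω, f (chain θ x (t + 1) ω) ∂(noise L)
      = ∫⁻ u, ∫⁻ ω, f (chain θ (step θ x u) t ω) ∂(noise L) ∂(stepLaw L) := by
  rw [lintegral_noise_eq (f := fun ω => f (chain θ x (t + 1) ω))
    ((measurable_of_countable f).comp (measurable_chain θ x (t + 1)))]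
  simp_rw [chain_prepend]

/-! ### Second moments of sums of centred increments -/

/-- The sum of `f` along the first `t` transitions of the chain started from `x`. -/
def pathSum (f : State L → (Class L → ℝ) → ℝ) (x : State L) (t : ℕ) (ω : Ω L) : ℝ :=
  ∑ s ∈ Finset.range t, f (chain θ x s ω) (ω s)

variable {θ} {f : State L → (Class L → ℝ) → ℝ}

theorem measurable_pathSum (hf : ∀ x, Measurable (f x)) (x : State L) (t : ℕ) :
    Measurable (pathSum θ f x t) := by
  refine Finset.measurable_fun_sum _ fun s _ => ?_
  have h : Measurable fun z : State L × (Class L → ℝ) => f z.1 z.2 :=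
    measurable_from_prod_countable_right hf
  exact h.comp ((measurable_chain θ x s).prodMk (measurable_pi_apply s))

theorem pathSum_prepend (x : State L) (t : ℕ) (z : (Class L → ℝ) × Ω L) :
    pathSum θ f x (t + 1) (prepend z) = f x z.1 + pathSum θ f (step θ x z.1) t z.2 := by
  rw [pathSum, Finset.sum_range_succ', add_comm]
  simp only [chain_prepend]
  rfl

theorem abs_pathSum_le (hb : ∀ x u, |f x u| ≤ 1) (x : State L) (t : ℕ) (ω : Ω L) :
    |pathSum θ f x t ω| ≤ t := by
  refine (Finset.abs_sum_le_sum_abs _ _).trans ?_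
  exact (Finset.sum_le_sum fun s _ => hb _ _).trans (by simp)

theorem integral_pathSum (hf : ∀ x, Measurable (f x)) (hb : ∀ x u, |f x u| ≤ 1)
    (h0 : ∀ x, ∫ u, f x u ∂(stepLaw L) = 0) (x : State L) (t : ℕ) :
    ∫ ω, pathSum θ f x t ω ∂(noise L) = 0 := by
  induction t generalizing x with
  | zero => simp [pathSum]
  | succ t ih =>
    rw [integral_noise_eq (measurable_pathSum hf x _) (abs_pathSum_le hb x _)]
    simp_rw [pathSum_prepend]
    have hi : ∀ y : State L, Integrable (pathSum θ f y t) (noise L) := fun y =>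
      .of_bound (C := t) (measurable_pathSum hf y t).aestronglyMeasurable
        (.of_forall (abs_pathSum_le hb y t))
    simp_rw [integral_add (integrable_const _) (hi _), ih]
    simpa using h0 x

/-- Martingale increments are orthogonal. Splitting off the first step, the cross term vanishes
because the remaining sum has mean zero from every state, so each step adds at most one to the
second moment. -/
theorem integral_pathSum_sq_le (hf : ∀ x, Measurable (f x)) (hb : ∀ x u, |f x u| ≤ 1)
    (h0 : ∀ x, ∫ u, f x u ∂(stepLaw L) = 0) (x : State L) (t : ℕ) :
    ∫ ω, pathSum θ f x t ω ^ 2 ∂(noise L) ≤ t := by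
  induction t generalizing x with
  | zero => simp [pathSum]
  | succ t ih =>
    have hsq : ∀ (y : State L) (t : ℕ) (ω : Ω L), |pathSum θ f y t ω ^ 2| ≤ (t : ℝ) ^ 2 :=
      fun y t ω => by
        rw [abs_pow]
        exact pow_le_pow_left₀ (abs_nonneg _) (abs_pathSum_le hb y t ω) 2
    rw [integral_noise_eq ((measurable_pathSum hf x _).pow_const 2) (hsq x _)]
    simp_rw [pathSum_prepend, add_sq]
    have hi : ∀ y : State L, Integrable (pathSum θ f y t) (noise L) := fun y =>
      .of_bound (C := t) (measurable_pathSum hf y t).aestronglyMeasurable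
        (.of_forall (abs_pathSum_le hb y t))
    have hi2 : ∀ y : State L, Integrable (fun ω => pathSum θ f y t ω ^ 2) (noise L) := fun y =>
      .of_bound (C := (t : ℝ) ^ 2) ((measurable_pathSum hf y t).pow_const 2).aestronglyMeasurable
        (.of_forall (hsq y t))
    have hu : ∀ u, ∫ ω, (f x u ^ 2 + 2 * f x u * pathSum θ f (step θ x u) t ω
        + pathSum θ f (step θ x u) t ω ^ 2) ∂(noise L) ≤ (t : ℝ) + 1 := fun u => by
      have hi' : Integrable (fun ω => f x u ^ 2 + 2 * f x u * pathSum θ f (step θ x u) t ω)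
          (noise L) := (integrable_const _).add ((hi _).const_mul _)
      rw [integral_add hi' (hi2 _),
        integral_add (integrable_const _) ((hi _).const_mul _), integral_const_mul,
        integral_pathSum hf hb h0]
      have h1 := ih (step θ x u)
      have h2 : f x u ^ 2 ≤ 1 := (sq_le_one_iff_abs_le_one _).mpr (hb x u)
      simp only [integral_const, probReal_univ, smul_eq_mul]
      linarith
    have hn : ∀ u, 0 ≤ ∫ ω, (f x u ^ 2 + 2 * f x u * pathSum θ f (step θ x u) t ω
        + pathSum θ f (step θ x u) t ω ^ 2) ∂(noise L) := fun u =>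
      integral_nonneg fun ω => by
        have := sq_nonneg (f x u + pathSum θ f (step θ x u) t ω)
        simp only [Pi.zero_apply]; linarith
    calc _ ≤ ∫ _u : Class L → ℝ, ((t : ℝ) + 1) ∂(stepLaw L) :=
          integral_mono_of_nonneg (.of_forall hn) (integrable_const _) (.of_forall hu)
      _ = _ := by simp

end

/-! ### A drift criterion -/

section

variable {L : ℕ} [NeZero L] (θ : Params L)

open Classical in
/-- The transition operator of the chain killed on entering the state `y`. -/
def killed (y : State L) (f : State L → ℝ≥0∞) (x : State L) : ℝ≥0∞ :=
  ∫⁻ u, (if step θ x u = y then 0 else f (step θ x u)) ∂(stepLaw L)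

/-- The expectation of the minimum of `N` and the first time `n ≥ 1` at which the chain started
from the given state is in the state `y`. -/
def truncTime (y : State L) : ℕ → State L → ℝ≥0∞
  | 0 => 0
  | N + 1 => fun x => 1 + killed θ y (truncTime y N) x

variable {θ} {y : State L} {f g : State L → ℝ≥0∞}

theorem killed_mono (h : f ≤ g) : killed θ y f ≤ killed θ y g := fun x =>
  lintegral_mono fun u => by
    dsimp only; split_ifs
    exacts [le_rfl, h _]

theorem killed_add : killed θ y (f + g) = killed θ y f + killed θ y g := by
  classical
  funext x
  have hm : Measurable fun u => if step θ x u = y then 0 else f (step θ x u) :=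
    (measurable_of_countable fun z => if z = y then 0 else f z).comp (measurable_step θ x)
  rw [Pi.add_apply, killed, killed, killed, ← lintegral_add_left hm]
  exact lintegral_congr fun u => by split_ifs <;> simp

theorem killed_const_mul (c : ℝ≥0∞) : killed θ y (fun x => c * f x) = fun x => c * killed θ y f x := by
  classical
  funext x
  have hm : Measurable fun u => if step θ x u = y then 0 else f (step θ x u) :=
    (measurable_of_countable fun z => if z = y then 0 else f z).comp (measurable_step θ x)
  rw [killed, killed, ← lintegral_const_mul _ hm]
  exact lintegral_congr fun u => by split_ifs <;> simp

theorem killed_iterate_mono (h : f ≤ g) (n : ℕ) : (killed θ y)^[n] f ≤ (killed θ y)^[n] g :=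
  Monotone.iterate (fun _ _ => killed_mono) n h

theorem killed_iterate_add_const (c : ℝ≥0∞) (n : ℕ) :
    (killed θ y)^[n] (fun x => f x + c)
      = fun x => (killed θ y)^[n] f x + c * (killed θ y)^[n] 1 x := by
  induction n with
  | zero => simp
  | succ n ih =>
    rw [Function.iterate_succ_apply', ih, Function.iterate_succ_apply',
      Function.iterate_succ_apply']
    refine killed_add.trans ?_
    rw [killed_const_mul]
    rfl

theorem killed_iterate_le (n : ℕ) (x : State L) :
    (killed θ y)^[n] f x ≤ ∫⁻ ω, f (chain θ x n ω) ∂(noise L) := by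
  induction n generalizing x with
  | zero => simp [chain]
  | succ n ih =>
    rw [Function.iterate_succ_apply', lintegral_chain_succ]
    refine lintegral_mono fun u => ?_
    dsimp only; split_ifs
    exacts [zero_le, ih _]

open Classical in
theorem noise_chain_eq (n : ℕ) (x y : State L) : noise L {ω | chain θ x n ω = y}
    = ∫⁻ ω, (if chain θ x n ω = y then 1 else 0) ∂(noise L) := by
  have h : MeasurableSet {ω | chain θ x n ω = y} :=
    measurable_chain θ x n (measurableSet_singleton y)
  rw [← lintegral_indicator_one h]
  exact lintegral_congr fun ω => by simp [Set.indicator_apply]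

/-- `(killed θ y)^[n] 1 x` is the probability of avoiding `y` at times `1, …, n`, an event disjoint
from being at `y` at time `n`. For `n = 0` the killed term is already one, hence `1 ≤ n`. -/
theorem killed_iterate_one_add_le {n : ℕ} (hn : 1 ≤ n) (x : State L) :
    (killed θ y)^[n] 1 x + noise L {ω | chain θ x n ω = y} ≤ 1 := by
  classical
  have hm : ∀ (x : State L) (f : State L → ℝ≥0∞),
      Measurable fun u => if step θ x u = y then 0 else f (step θ x u) := fun x f =>
    (measurable_of_countable fun z => if z = y then 0 else f z).comp (measurable_step θ x)
  induction n, hn using Nat.le_induction generalizing x with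
  | base =>
    rw [noise_chain_eq, lintegral_chain_succ (f := fun z => if z = y then 1 else 0),
      Function.iterate_one, killed, ← lintegral_add_left (hm x 1)]
    calc _ ≤ ∫⁻ _u : Class L → ℝ, 1 ∂(stepLaw L) :=
          lintegral_mono fun u => by simp only [chain]; split_ifs <;> simp [*]
      _ = 1 := by simp
  | succ n hn ih =>
    rw [noise_chain_eq, lintegral_chain_succ (f := fun z => if z = y then 1 else 0),
      Function.iterate_succ_apply', killed, ← lintegral_add_left (hm x _)]
    simp_rw [← noise_chain_eq]
    calc _ ≤ ∫⁻ _u : Class L → ℝ, 1 ∂(stepLaw L) :=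
          lintegral_mono fun u => by
            dsimp only; split_ifs with h
            · simpa using prob_le_one
            · exact ih _
      _ = 1 := by simp

theorem killed_const_le (c : ℝ≥0∞) (x : State L) : killed θ y (fun _ => c) x ≤ c := by
  calc _ ≤ ∫⁻ _u : Class L → ℝ, c ∂(stepLaw L) :=
        lintegral_mono fun u => by dsimp only; split_ifs <;> simp
    _ = c := by simp

theorem truncTime_le (N : ℕ) (x : State L) : truncTime θ y N x ≤ N := by
  induction N generalizing x with
  | zero => simp [truncTime]
  | succ N ih =>
    rw [truncTime, add_comm]
    push_cast
    gcongr
    exact (killed_mono (g := fun _ => (N : ℝ≥0∞)) ih x).trans (killed_const_le _ x)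

theorem truncTime_le_succ (N : ℕ) : truncTime θ y N ≤ truncTime θ y (N + 1) := by
  induction N with
  | zero => exact fun x => zero_le
  | succ N ih => exact fun x => add_le_add_right (killed_mono ih x) 1

/-- Within `n` steps the truncated time costs at most `n`, and only surviving paths pay more.
Monotonicity in the truncation level keeps the same `N` on both sides, which makes a self-bounding
inequality possible. -/
theorem truncTime_le_add_killed_iterate (N n : ℕ) (x : State L) :
    truncTime θ y N x ≤ n + (killed θ y)^[n] (truncTime θ y N) x := by
  induction n generalizing x with
  | zero => simp
  | succ n ih =>
    calc truncTime θ y N x ≤ 1 + killed θ y (truncTime θ y N) x := truncTime_le_succ N x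
      _ ≤ 1 + killed θ y ((fun _ => (n : ℝ≥0∞)) + (killed θ y)^[n] (truncTime θ y N)) x := by
        gcongr
        exact killed_mono ih x
      _ ≤ 1 + (n + (killed θ y)^[n + 1] (truncTime θ y N) x) := by
        rw [killed_add, Pi.add_apply, Function.iterate_succ_apply']
        gcongr
        exact killed_const_le _ x
      _ = _ := by push_cast; ring

theorem measurable_returnTime (x y : State L) : Measurable (returnTime θ x y) := by
  classical
  refine Measurable.iInf fun n => ?_
  have h : (fun ω => ⨅ (_ : 1 ≤ n ∧ chain θ x n ω = y), (n : ℝ≥0∞))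
      = fun ω => if 1 ≤ n ∧ chain θ x n ω = y then (n : ℝ≥0∞) else ⊤ := by
    funext ω
    split_ifs with h <;> simp [h]
  rw [h]
  refine Measurable.ite ?_ measurable_const measurable_const
  exact (MeasurableSet.const _).inter (measurable_chain θ x n (measurableSet_singleton y))

/-- First-step analysis: the time is one if the first step hits `y`, and otherwise at most one plus
the return time from the new state. -/
theorem lintegral_min_returnTime_le (N : ℕ) (x : State L) :
    ∫⁻ ω, min (returnTime θ x y ω) N ∂(noise L) ≤ truncTime θ y N x := by
  classical
  induction N generalizing x with
  | zero => simp
  | succ N ih =>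
    rw [lintegral_noise_eq ((measurable_returnTime x y).min measurable_const), truncTime]
    calc _ ≤ ∫⁻ u, (1 + if step θ x u = y then 0 else truncTime θ y N (step θ x u))
            ∂(stepLaw L) := lintegral_mono fun u => ?_
      _ = _ := by rw [lintegral_add_left measurable_const]; simp [killed]
    dsimp only
    split_ifs with h
    · calc _ ≤ ∫⁻ _ω : Ω L, 1 ∂(noise L) := lintegral_mono fun ω => by
            refine (min_le_left _ _).trans (iInf₂_le_of_le 1 ⟨le_rfl, ?_⟩ (by simp))
            rw [chain_prepend]
            exact h
        _ = _ := by simp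
    · refine le_trans (lintegral_mono (g := fun ω => 1 + min (returnTime θ (step θ x u) y ω) N)
        fun ω => ?_) ?_
      · dsimp only
        rw [← min_add_add_left]
        refine min_le_min ?_ (by push_cast; rw [add_comm])
        rw [returnTime, returnTime, ENNReal.add_iInf]
        refine le_iInf fun n => ?_
        by_cases hn : 1 ≤ n ∧ chain θ (step θ x u) n ω = y
        · refine iInf₂_le_of_le (n + 1) ⟨by omega, ?_⟩ ?_
          · rw [chain_prepend]
            exact hn.2
          · simp [hn, add_comm]
        · simp [hn]
      · rw [lintegral_add_left measurable_const]
        simpa using ih _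

theorem lintegral_returnTime_le (x y : State L) :
    ∫⁻ ω, returnTime θ x y ω ∂(noise L) ≤ ⨆ N, truncTime θ y N x := by
  have h : ∀ ω, returnTime θ x y ω = ⨆ N : ℕ, min (returnTime θ x y ω) N := fun ω => by
    rw [← inf_iSup_eq, ENNReal.iSup_natCast, inf_top_eq]
  rw [lintegral_congr h, lintegral_iSup fun N => (measurable_returnTime x y).min measurable_const]
  · exact iSup_mono fun N => lintegral_min_returnTime_le N x
  · exact fun N M hNM ω => min_le_min le_rfl (by exact_mod_cast hNM)

/-- A state-dependent drift criterion: if `V` decreases in the mean by more than `n x` in the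
`n x` steps after leaving a state `x` outside a finite set, and `y` can be reached from the states
of this set, then `y` is reached in finite mean time from every state. -/
theorem lintegral_returnTime_lt_top_of_drift {V : State L → ℝ≥0∞}
    (hV : ∀ x m, ∫⁻ ω, V (chain θ x m ω) ∂(noise L) ≠ ∞) {B : Set (State L)} (hB : B.Finite)
    {n : State L → ℕ}
    (hdrift : ∀ x ∉ B, ∫⁻ ω, V (chain θ x (n x) ω) ∂(noise L) + n x + 1 ≤ V x)
    (hreach : ∀ x ∈ B, ∃ m, 1 ≤ m ∧ 0 < noise L {ω | chain θ x m ω = y}) (x : State L) :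
    ∫⁻ ω, returnTime θ x y ω ∂(noise L) < ∞ := by
  classical
  choose! m hm1 hm using hreach
  -- A lower bound for the hitting probabilities, uniform over the finite set `B`; the minimum with
  -- one covers empty `B` and keeps `1 - ε` a true difference.
  obtain ⟨ε, hε0, hε1, hε⟩ : ∃ ε : ℝ≥0∞, 0 < ε ∧ ε ≤ 1 ∧
      ∀ x ∈ B, ε ≤ noise L {ω | chain θ x (m x) ω = y} := by
    refine ⟨min 1 (hB.toFinset.inf fun x => noise L {ω | chain θ x (m x) ω = y}),
      lt_min one_pos ?_, min_le_left _ _, fun x hx => (min_le_right _ _).trans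
        (Finset.inf_le (hB.mem_toFinset.mpr hx))⟩
    exact (Finset.lt_inf_iff ENNReal.zero_lt_top).mpr fun x hx => hm x (hB.mem_toFinset.mp hx)
  obtain ⟨c, hc, hcB⟩ : ∃ c : ℝ≥0∞, c ≠ ∞ ∧
      ∀ x ∈ B, m x + ∫⁻ ω, V (chain θ x (m x) ω) ∂(noise L) ≤ c := by
    refine ⟨∑ x ∈ hB.toFinset, (m x + ∫⁻ ω, V (chain θ x (m x) ω) ∂(noise L)), ?_,
      fun x hx => Finset.single_le_sum (f := fun x => (m x : ℝ≥0∞)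
        + ∫⁻ ω, V (chain θ x (m x) ω) ∂(noise L)) (fun _ _ => zero_le)
          (hB.mem_toFinset.mpr hx)⟩
    exact ENNReal.sum_ne_top.mpr fun x _ => by simp [hV]
  have hVx : ∀ x, V x ≠ ∞ := fun x => by simpa [chain] using hV x 0
  have key : ∀ N x, truncTime θ y N x ≤ V x + c / ε := fun N => by
    -- `D` is the largest excess of the truncated time over `V`. Truncation makes it finite, so it
    -- can be cancelled in inequalities bounding it by itself; the resulting bound does not depend
    -- on `N`.
    set D : ℝ≥0∞ := ⨆ x, truncTime θ y N x - V x with hD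
    have hDtop : D ≠ ∞ := ne_top_of_le_ne_top (ENNReal.natCast_ne_top N)
      (iSup_le fun x => tsub_le_self.trans (truncTime_le N x))
    have hle : ∀ x, truncTime θ y N x ≤ V x + D := fun x =>
      tsub_le_iff_left.mp (le_iSup (fun x => truncTime θ y N x - V x) x)
    have hstep : ∀ n x, truncTime θ y N x
        ≤ n + ((killed θ y)^[n] V x + D * (killed θ y)^[n] 1 x) := fun n x => by
      refine (truncTime_le_add_killed_iterate N n x).trans ?_
      gcongr
      exact (killed_iterate_mono hle n x).trans_eq (congrFun (killed_iterate_add_const D n) x)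
    have hout : ∀ x ∉ B, truncTime θ y N x - V x ≤ D - 1 := fun x hx => by
      have h1 : (killed θ y)^[n x] 1 x ≤ 1 :=
        (killed_iterate_le (n x) x).trans (by simp)
      have h2 : truncTime θ y N x + 1 ≤ V x + D := by
        calc _ ≤ n x + ((killed θ y)^[n x] V x + D * (killed θ y)^[n x] 1 x) + 1 := by
              gcongr; exact hstep _ _
          _ ≤ n x + (∫⁻ ω, V (chain θ x (n x) ω) ∂(noise L) + D * 1) + 1 := by
              gcongr; exact killed_iterate_le _ _
          _ = (∫⁻ ω, V (chain θ x (n x) ω) ∂(noise L) + n x + 1) + D := by ring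
          _ ≤ _ := by gcongr; exact hdrift x hx
      rcases le_total (truncTime θ y N x) (V x) with h | h
      · simp [tsub_eq_zero_of_le h]
      · refine ENNReal.le_sub_of_add_le_right (by simp) ?_
        rw [← ENNReal.add_le_add_iff_left (hVx x), ← add_assoc, add_tsub_cancel_of_le h]
        exact h2
    -- From `B` the chain hits `y` within `m x` steps with probability at least `ε`, so `D` is
    -- inherited only with weight `1 - ε`.
    have hin : ∀ x ∈ B, truncTime θ y N x - V x ≤ c + D * (1 - ε) := fun x hx => by
      refine tsub_le_self.trans ((hstep (m x) x).trans ?_)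
      rw [← add_assoc]
      refine add_le_add (le_trans ?_ (hcB x hx)) ?_
      · gcongr; exact killed_iterate_le _ _
      · gcongr
        refine ENNReal.le_sub_of_add_le_right (ne_top_of_le_ne_top (by simp) hε1) ?_
        exact le_trans (by gcongr; exact hε x hx) (killed_iterate_one_add_le (hm1 x hx) x)
    have hmax : D ≤ max (D - 1) (c + D * (1 - ε)) := iSup_le fun x => by
      by_cases hx : x ∈ B
      exacts [le_max_of_le_right (hin x hx), le_max_of_le_left (hout x hx)]
    -- The supremum cannot be governed by `D - 1` unless `D = 0`; otherwise `D ≤ c + D * (1 - ε)` is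
    -- solved for `D`.
    have hDc : D ≤ c / ε := by
      rcases le_max_iff.mp hmax with h | h
      · rcases eq_or_ne D 0 with h0 | h0
        · simp [h0]
        · exact absurd h (not_le.mpr (ENNReal.sub_lt_self hDtop h0 one_ne_zero))
      · rw [ENNReal.le_div_iff_mul_le (.inl hε0.ne') (.inl (ne_top_of_le_ne_top (by simp) hε1))]
        have h3 : D * ε + D * (1 - ε) = D := by
          rw [← mul_add, add_tsub_cancel_of_le hε1, mul_one]
        rw [← h3] at h
        refine (ENNReal.add_le_add_iff_right
          (ENNReal.mul_ne_top hDtop (by simp))).mp (h.trans_eq ?_)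
        rw [h3]
    exact fun x => (hle x).trans (by gcongr)
  refine (lintegral_returnTime_le x y).trans_lt ((iSup_le fun N => key N x).trans_lt ?_)
  exact ENNReal.add_lt_top.mpr ⟨(hVx x).lt_top, ENNReal.div_lt_top hc hε0.ne'⟩

end

/-! ### Accessibility -/

section

variable {L : ℕ} (θ : Params L)

/-- Driving numbers for which nobody arrives and every customer leaves at the first opportunity. -/
def drainInput : Class L → ℝ
  | (_, none) => 1
  -- If `q i j = 0`, departure has probability zero and the customer has to move on.
  | (i, some j) => if θ.q i j = 0 then 1 else 0

/-- The driving numbers with the same effect as `drainInput`. -/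
def drainSet : Set (Class L → ℝ) :=
  Set.univ.pi fun
    | (i, none) => Set.Ioi (θ.p i)
    | (i, some j) => if θ.q i j = 0 then Set.Ioi 0 else Set.Iic (θ.q i j)

theorem mem_drainSet {u : Class L → ℝ} (hu : u ∈ drainSet θ) :
    (∀ i, ¬ u (i, none) ≤ θ.p i) ∧ ∀ i j, θ.q i j < u (i, some j) ↔ θ.q i j = 0 := by
  refine ⟨fun i => not_le.mpr (hu (i, none) trivial), fun i j => ?_⟩
  have h : u (i, some j) ∈ if θ.q i j = 0 then Set.Ioi 0 else Set.Iic (θ.q i j) :=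
    hu (i, some j) trivial
  split_ifs at h with h0
  · simpa [h0] using h
  · simpa [h0] using h

theorem drainInput_mem : drainInput θ ∈ drainSet θ := by
  rintro ⟨i, _ | j⟩ -
  · exact θ.p_lt_one i
  · change (if θ.q i j = 0 then (1 : ℝ) else 0) ∈ if θ.q i j = 0 then Set.Ioi 0 else Set.Iic (θ.q i j)
    split_ifs
    · exact one_pos (α := ℝ)
    · exact θ.q_nonneg i j

theorem unif_Ioo_pos {a b : ℝ} (ha : 0 ≤ a) (hab : a < b) (hb : b ≤ 1) : 0 < unif (Set.Ioo a b) := by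
  rw [unif, Measure.restrict_apply measurableSet_Ioo,
    Set.inter_eq_left.mpr (Set.Ioo_subset_Ioo ha hb), Real.volume_Ioo]
  simpa using hab

theorem stepLaw_drainSet_pos : 0 < stepLaw L (drainSet θ) := by
  rw [drainSet, Measure.pi_pi]
  refine (CanonicallyOrderedAdd.prod_pos).mpr ?_
  rintro ⟨i, _ | j⟩ -
  · exact (unif_Ioo_pos (θ.p_nonneg i) (θ.p_lt_one i) le_rfl).trans_le
      (measure_mono Set.Ioo_subset_Ioi_self)
  · dsimp only
    split_ifs with h
    · exact (unif_Ioo_pos le_rfl one_pos le_rfl).trans_le (measure_mono Set.Ioo_subset_Ioi_self)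
    · exact (unif_Ioo_pos le_rfl ((θ.q_nonneg i j).lt_of_ne' h) (θ.q_le_one i j)).trans_le
        (measure_mono (Set.Ioo_subset_Iio_self.trans Set.Iio_subset_Iic_self))

variable [NeZero L]

open scoped Fin.CommRing in
-- `r i j` is one plus the number of moves from station `i` to the first station where type `j` can
-- leave. Such a station exists because otherwise the product of the `1 - q l j` would be one.
theorem exists_remaining : ∃ r : Fin L → Fin L → ℕ, (∀ i j, 1 ≤ r i j) ∧
    ∀ i j, θ.q i j = 0 → r (i + 1) j + 1 ≤ r i j := by
  classical
  have h : ∀ i j, ∃ k : ℕ, θ.q (i + (k : Fin L)) j ≠ 0 := by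
    intro i j
    by_contra! h
    refine (θ.prod_lt_one j).ne (Finset.prod_eq_one fun l _ => ?_)
    have := h (l - i).val
    rw [Fin.cast_val_eq_self, add_sub_cancel] at this
    rw [this, sub_zero]
  refine ⟨fun i j => Nat.find (h i j) + 1, fun i j => Nat.le_add_left _ _, fun i j hq => ?_⟩
  have h0 : Nat.find (h i j) ≠ 0 := fun h0 => by
    have := Nat.find_spec (h i j)
    rw [h0, Nat.cast_zero, add_zero] at this
    exact this hq
  obtain ⟨k, hk⟩ := Nat.exists_eq_succ_of_ne_zero h0
  have : Nat.find (h (i + 1) j) ≤ k := Nat.find_min' _ <| by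
    have := Nat.find_spec (h i j)
    rw [hk] at this
    rwa [add_assoc, add_comm 1, ← Nat.cast_succ]
  dsimp only
  omega

theorem step_eq_of_mem_drainSet {u : Class L → ℝ} (hu : u ∈ drainSet θ) (x : State L) :
    step θ x u = step θ x (drainInput θ) := by
  have h1 := mem_drainSet θ hu
  have h2 := mem_drainSet θ (drainInput_mem θ)
  funext i
  refine Prod.ext ?_ (Subtype.ext (funext fun j => ?_))
  · simp only [step, h1.1, h2.1]
  · simp only [step, transfer, h1.2, h2.2]

variable {θ}

/-- A ring customer weighs its remaining number of steps `r i j`, and a waiting external customer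
weighs `R + 1`, more than any ring customer. Under the draining input every customer that is served
or moves loses weight, and a nonempty network always has one. -/
theorem exists_potential : ∃ Φ : State L → ℕ,
    ∀ x, x ≠ emptyState L → Φ (step θ x (drainInput θ)) < Φ x := by
  classical
  obtain ⟨r, hr1, hr⟩ := exists_remaining θ
  set R : ℕ := ∑ i, ∑ j, r i j
  have hrR : ∀ i j, r i j ≤ R := fun i j =>
    (Finset.single_le_sum (f := r i) (fun _ _ => Nat.zero_le _) (Finset.mem_univ j)).trans
      (Finset.single_le_sum (f := fun i => ∑ j, r i j) (fun _ _ => Nat.zero_le _)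
        (Finset.mem_univ i))
  have hd := mem_drainSet θ (drainInput_mem θ)
  refine ⟨fun x => ∑ i, ((R + 1) * (x i).1 + ∑ j, r i j * (x i).2.1 j), fun x hx => ?_⟩
  set s : Fin L → ℕ := fun i => if ServesExternal x i then 1 else 0 with hs
  have h1 : ∑ i, ((R + 1) * (step θ x (drainInput θ) i).1
      + ∑ j, r i j * (step θ x (drainInput θ) i).2.1 j)
      = ∑ i, ((R + 1) * ((x i).1 - s i) + ∑ j, r (i + 1) j * transfer θ x (drainInput θ) i j) := by
    rw [Finset.sum_add_distrib, Finset.sum_add_distrib]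
    congr 1
    · exact Finset.sum_congr rfl fun i _ => by simp [step, hd.1, hs]
    · rw [← Equiv.sum_comp (Equiv.addRight (1 : Fin L))]
      simp [step]
  have h2 : ∀ i, (R + 1) * ((x i).1 - s i)
      + ∑ j, r (i + 1) j * transfer θ x (drainInput θ) i j + (s i + ∑ j, (x i).2.1 j)
      ≤ (R + 1) * (x i).1 + ∑ j, r i j * (x i).2.1 j := fun i => by
    have h3 : ∀ j, r (i + 1) j * transfer θ x (drainInput θ) i j + (x i).2.1 j
        ≤ (if i = j then R * s i else 0) + r i j * (x i).2.1 j := fun j => by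
      have ha : r (i + 1) j * (if i = j ∧ ServesExternal x i then 1 else 0)
          ≤ if i = j then R * s i else 0 := by
        by_cases hij : i = j
        · subst hij
          by_cases hse : ServesExternal x i <;> simp [hse, hs, hrR]
        · simp [hij]
      have hb : r (i + 1) j * (if θ.q i j = 0 then (x i).2.1 j else 0) + (x i).2.1 j
          ≤ r i j * (x i).2.1 j := by
        split_ifs with hq
        · calc _ = (r (i + 1) j + 1) * (x i).2.1 j := by ring
            _ ≤ _ := by gcongr; exact hr i j hq
        · simpa using Nat.mul_le_mul_right ((x i).2.1 j) (hr1 i j)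
      simp only [transfer, hd.2, mul_add]
      omega
    have h4 := Finset.sum_le_sum fun j (_ : j ∈ Finset.univ) => h3 j
    simp only [Finset.sum_add_distrib, Finset.sum_ite_eq, Finset.mem_univ, if_true] at h4
    have h5 : (R + 1) * ((x i).1 - s i) + (R + 1) * s i = (R + 1) * (x i).1 := by
      rw [← mul_add, Nat.sub_add_cancel]
      simp only [hs]; split_ifs with h
      exacts [h.1, Nat.zero_le _]
    rw [add_mul R 1 (s i)] at h5
    omega
  have h6 : 0 < ∑ i, (s i + ∑ j, (x i).2.1 j) := by
    by_contra h0
    have h0 := Finset.sum_eq_zero_iff.mp (Nat.eq_zero_of_not_pos h0)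
    refine hx (funext fun i => ?_)
    have hi := h0 i (Finset.mem_univ i)
    have hv : ∑ j, (x i).2.1 j = 0 := by omega
    have hsi : s i = 0 := by omega
    refine Prod.ext ?_ (Subtype.ext (funext fun j => ?_))
    · by_contra hpos
      have : ServesExternal x i := ⟨Nat.pos_of_ne_zero hpos, hv⟩
      simp [hs, this] at hsi
    · exact Finset.sum_eq_zero_iff.mp hv j (Finset.mem_univ j)
  have h7 := Finset.sum_le_sum fun i (_ : i ∈ Finset.univ) => h2 i
  rw [Finset.sum_add_distrib] at h7
  dsimp only
  rw [h1]
  omega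

theorem noise_chain_succ_pos {x y z : State L} {m : ℕ}
    (hz : 0 < stepLaw L {u | step θ x u = z}) (hm : 0 < noise L {ω | chain θ z m ω = y}) :
    0 < noise L {ω | chain θ x (m + 1) ω = y} := by
  classical
  rw [noise_chain_eq, lintegral_chain_succ (f := fun z => if z = y then 1 else 0)]
  simp_rw [← noise_chain_eq]
  have hA : MeasurableSet {u | step θ x u = z} := measurable_step θ x (measurableSet_singleton z)
  calc 0 < noise L {ω | chain θ z m ω = y} * stepLaw L {u | step θ x u = z} :=
        ENNReal.mul_pos hm.ne' hz.ne'
    _ = ∫⁻ u in {u | step θ x u = z}, noise L {ω | chain θ (step θ x u) m ω = y} ∂(stepLaw L) := by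
        rw [← setLIntegral_const]
        exact setLIntegral_congr_fun hA fun u (hu : _ = z) => by rw [hu]
    _ ≤ _ := setLIntegral_le_lintegral _ _

/-- States accessible from the empty state are accessible from all states. -/
theorem exists_noise_chain_pos {y : State L} (hy : Accessible θ (emptyState L) y) (x : State L) :
    ∃ m, 1 ≤ m ∧ 0 < noise L {ω | chain θ x m ω = y} := by
  obtain ⟨Φ, hΦ⟩ := exists_potential (θ := θ)
  have hdrain : ∀ x, 0 < stepLaw L {u | step θ x u = step θ x (drainInput θ)} := fun x =>
    (stepLaw_drainSet_pos θ).trans_le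
      (measure_mono fun u hu => step_eq_of_mem_drainSet θ hu x)
  have h : ∀ N x, Φ x < N → ∃ m, 0 < noise L {ω | chain θ x m ω = y} := by
    intro N
    induction N with
    | zero => exact fun x h => absurd h (Nat.not_lt_zero _)
    | succ N ih =>
      intro x hx
      by_cases he : x = emptyState L
      · rw [he]; exact hy
      · obtain ⟨m, hm⟩ := ih _ ((hΦ x he).trans_le (Nat.lt_succ_iff.mp hx))
        exact ⟨m + 1, noise_chain_succ_pos (hdrain x) hm⟩
  -- One draining step is taken beforehand to ensure `1 ≤ m`.
  obtain ⟨m, hm⟩ := h _ (step θ x (drainInput θ)) (Nat.lt_succ_self _)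
  exact ⟨m + 1, Nat.le_add_left _ _, noise_chain_succ_pos (hdrain x) hm⟩

end

open Filter Topology

/-! ### Scaling limits along ultrafilters -/

/-- The sequence `z` with time and space scaled by `a`. -/
def scaled (a : ℝ) (z : ℕ → ℝ) (t : ℝ≥0) : ℝ := z ⌊(t : ℝ) * a⌋₊ / a

theorem abs_sub_le_of_abs_succ_sub_le {z : ℕ → ℝ} (hz : ∀ k, |z (k + 1) - z k| ≤ 1) (m n : ℕ) :
    |z n - z m| ≤ |(n : ℝ) - m| := by
  wlog h : m ≤ n generalizing m n
  · rw [abs_sub_comm, abs_sub_comm (n : ℝ)]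
    exact this n m (le_of_not_ge h)
  induction n, h using Nat.le_induction with
  | base => simp
  | succ n hn ih =>
    have h1 : (m : ℝ) ≤ n := by exact_mod_cast hn
    rw [abs_of_nonneg (sub_nonneg.mpr h1)] at ih
    push_cast
    rw [abs_of_nonneg (a := (n : ℝ) + 1 - m) (by linarith)]
    have := abs_sub_le (z (n + 1)) (z n) (z m)
    linarith [hz n]

theorem abs_scaled_sub_le {z : ℕ → ℝ} (hz : ∀ k, |z (k + 1) - z k| ≤ 1) {a : ℝ} (ha : 0 < a)
    (s t : ℝ≥0) : |scaled a z t - scaled a z s| ≤ dist t s + a⁻¹ := by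
  have h1 := abs_sub_le_of_abs_succ_sub_le hz ⌊(s : ℝ) * a⌋₊ ⌊(t : ℝ) * a⌋₊
  have hs := Nat.floor_le (mul_nonneg s.coe_nonneg ha.le)
  have ht := Nat.floor_le (mul_nonneg t.coe_nonneg ha.le)
  have hs' := Nat.lt_floor_add_one ((s : ℝ) * a)
  have ht' := Nat.lt_floor_add_one ((t : ℝ) * a)
  have h2 : |(⌊(t : ℝ) * a⌋₊ : ℝ) - ⌊(s : ℝ) * a⌋₊| ≤ |(t : ℝ) * a - s * a| + 1 := by
    have h3 := le_abs_self ((t : ℝ) * a - s * a)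
    have h4 := neg_abs_le ((t : ℝ) * a - s * a)
    refine abs_le.mpr ⟨?_, ?_⟩ <;> linarith
  rw [← sub_mul, abs_mul, abs_of_pos ha] at h2
  rw [scaled, scaled, ← sub_div, abs_div, abs_of_pos ha, div_le_iff₀ ha, add_mul,
    inv_mul_cancel₀ ha.ne', NNReal.dist_eq]
  exact h1.trans h2

/-- Scaled paths are bounded at each time and Lipschitz up to the rounding error `(a n)⁻¹`.
Convergence of ultrafilters on compact intervals replaces the subsequence extraction of
Arzelà–Ascoli. -/
theorem exists_lipschitz_limit {ι : Type*} (𝒰 : Ultrafilter ι) {a : ι → ℝ}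
    (ha : Tendsto a 𝒰 atTop) {z : ι → ℕ → ℝ} (hz : ∀ n k, |z n (k + 1) - z n k| ≤ 1)
    (hz0 : ∀ n, |z n 0| ≤ a n) :
    ∃ Z : ℝ≥0 → ℝ, LipschitzWith 1 Z ∧
      ∀ t, Tendsto (fun n => scaled (a n) (z n) t) 𝒰 (𝓝 (Z t)) := by
  have hpos : ∀ᶠ n in 𝒰, 1 ≤ a n := ha.eventually_ge_atTop 1
  have hlim : ∀ t, ∃ c, Tendsto (fun n => scaled (a n) (z n) t) 𝒰 (𝓝 c) := fun t => by
    -- In `t + 2`, one unit bounds the scaled initial value and the other the rounding error.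
    obtain ⟨c, -, hc⟩ := (isCompact_Icc (a := -((t : ℝ) + 2)) (b := t + 2)).ultrafilter_le_nhds
      (𝒰.map fun n => scaled (a n) (z n) t) (by
        rw [le_principal_iff, Ultrafilter.coe_map, mem_map]
        filter_upwards [hpos] with n hn
        have hn0 : 0 < a n := one_pos.trans_le hn
        have h1 := abs_scaled_sub_le (hz n) hn0 0 t
        have h2 : |scaled (a n) (z n) 0| ≤ 1 := by
          simp only [scaled, NNReal.coe_zero, zero_mul, Nat.floor_zero]
          rw [abs_div, abs_of_pos hn0]
          exact div_le_one_of_le₀ (hz0 n) hn0.le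
        have h3 : (a n)⁻¹ ≤ 1 := inv_le_one_of_one_le₀ hn
        have h4 : dist t 0 = t := by simp [NNReal.dist_eq]
        rw [h4] at h1
        have h5 := abs_le.mp h1
        have h6 := abs_le.mp h2
        exact ⟨by linarith, by linarith⟩)
    exact ⟨c, hc⟩
  choose Z hZ using hlim
  refine ⟨Z, LipschitzWith.of_dist_le_mul fun s t => ?_, hZ⟩
  rw [NNReal.coe_one, one_mul, Real.dist_eq]
  have h1 := ((hZ s).sub (hZ t)).abs
  have h2 : Tendsto (fun n => dist s t + (a n)⁻¹) 𝒰 (𝓝 (dist s t + 0)) :=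
    tendsto_const_nhds.add (tendsto_inv_atTop_zero.comp ha)
  rw [add_zero] at h2
  refine le_of_tendsto_of_tendsto h1 h2 ?_
  filter_upwards [hpos] with n hn
  exact abs_scaled_sub_le (hz n) (one_pos.trans_le hn) t s

/-- Almost sure convergence comes with a null set depending on the time. Approximate Lipschitz
continuity extends it from countably many times to all times outside a single null set. -/
theorem tendsto_scaled_zero_of_dense {ι : Type*} {l : Filter ι} {a : ι → ℝ}
    (ha : Tendsto a l atTop) {z : ι → ℕ → ℝ} (hz : ∀ n k, |z n (k + 1) - z n k| ≤ 1)
    {S : Set ℝ≥0} (hS : Dense S) (h : ∀ t ∈ S, Tendsto (fun n => scaled (a n) (z n) t) l (𝓝 0))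
    (t : ℝ≥0) : Tendsto (fun n => scaled (a n) (z n) t) l (𝓝 0) := by
  rw [Metric.tendsto_nhds]
  intro ε hε
  obtain ⟨s, hs, hst⟩ := Metric.dense_iff.mp hS t (ε / 3) (by positivity)
  filter_upwards [Metric.tendsto_nhds.mp (h s hst) (ε / 3) (by positivity),
    ha.eventually_gt_atTop 0,
    (tendsto_inv_atTop_zero.comp ha).eventually_lt_const (show 0 < ε / 3 by positivity)]
    with n h1 h2 h3
  have h4 := abs_scaled_sub_le (hz n) h2 s t
  rw [Real.dist_0_eq_abs] at h1 ⊢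
  have h5 := abs_sub_abs_le_abs_sub (scaled (a n) (z n) t) (scaled (a n) (z n) s)
  rw [Metric.mem_ball, dist_comm] at hs
  simp only [Function.comp_apply] at h3
  linarith

/-! ### The dynamics in terms of queue lengths and work -/

section

variable {L : ℕ}

/-- The number of customers of each class. -/
def queue (x : State L) : Class L → ℕ
  | (i, none) => (x i).1
  | (i, some j) => (x i).2.1 j

/-- The number of customers in the network. -/
def total (x : State L) : ℕ := ∑ k, queue x k

open Classical in
/-- The amount of service given to each class in one step. -/
def work (x : State L) : Class L → ℝ
  | (i, none) => if ServesExternal x i then 1 else 0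
  | (i, some j) => (x i).2.1 j

theorem queue_le_total (x : State L) (k : Class L) : queue x k ≤ total x :=
  Finset.single_le_sum (f := queue x) (fun _ _ => Nat.zero_le _) (Finset.mem_univ k)

theorem ring_le_one (x : State L) (i j : Fin L) : (x i).2.1 j ≤ 1 :=
  (Finset.single_le_sum (f := (x i).2.1) (fun _ _ => Nat.zero_le _) (Finset.mem_univ j)).trans
    (x i).2.2

theorem work_nonneg (x : State L) (k : Class L) : 0 ≤ work x k := by
  obtain ⟨i, _ | j⟩ := k
  · simp only [work]; split_ifs <;> norm_num
  · simp [work]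

theorem work_le_one (x : State L) (k : Class L) : work x k ≤ 1 := by
  obtain ⟨i, _ | j⟩ := k
  · simp only [work]; split_ifs <;> norm_num
  · exact Nat.cast_le_one.mpr (ring_le_one x i j)

/-- A station holds at most one ring customer and serves an external one only when it holds none, so
it does at most one unit of work, and exactly one when external customers wait. This is work
conservation before scaling. -/
theorem one_sub_incidence_mulVec_work (x : State L) (i : Fin L) :
    0 ≤ 1 - (incidence L *ᵥ work x) i ∧ (0 < (x i).1 → 1 - (incidence L *ᵥ work x) i = 0) := by
  classical
  have h : (incidence L *ᵥ work x) i
      = (if ServesExternal x i then 1 else 0) + ((∑ j, (x i).2.1 j : ℕ) : ℝ) := by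
    simp only [Matrix.mulVec, dotProduct, incidence, Fintype.sum_prod_type, Fintype.sum_option,
      work, ite_mul, one_mul, zero_mul]
    rw [Finset.sum_eq_single i (fun b _ hb => by simp [hb]) (by simp)]
    simp
  rw [h]
  have h1 := (x i).2.2
  by_cases hs : ServesExternal x i
  · simp [hs, hs.2]
  · rw [if_neg hs, zero_add]
    refine ⟨sub_nonneg.mpr (by exact_mod_cast h1), fun hx => ?_⟩
    have h2 : ∑ j, (x i).2.1 j = 1 := by
      refine le_antisymm h1 (Nat.one_le_iff_ne_zero.mpr fun h0 => hs ⟨hx, h0⟩)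
    simp [h2]

end

section

variable {L : ℕ} [NeZero L] (θ : Params L)

open Classical in
/-- The deviation of the one-step change of the number of customers of class `k` from its
conditional mean. -/
def deviation : Class L → State L → (Class L → ℝ) → ℝ
  | (i, none), _, u => (if u (i, none) ≤ θ.p i then 1 else 0) - θ.p i
  | (i, some j), x, u => (x (i - 1)).2.1 j *
      ((if θ.q (i - 1) j < u (i - 1, some j) then 1 else 0) - (1 - θ.q (i - 1) j))

theorem abs_deviation_le (k : Class L) (x : State L) (u : Class L → ℝ) :
    |deviation θ k x u| ≤ 1 := by
  obtain ⟨i, _ | j⟩ := k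
  · have h0 := θ.p_nonneg i
    have h1 := θ.p_lt_one i
    rw [deviation, abs_le]
    split_ifs <;> constructor <;> linarith
  · have h0 := θ.q_nonneg (i - 1) j
    have h1 := θ.q_le_one (i - 1) j
    have h2 : ((x (i - 1)).2.1 j : ℝ) ≤ 1 := by exact_mod_cast ring_le_one x (i - 1) j
    rw [deviation, abs_mul, Nat.abs_cast]
    refine mul_le_one₀ h2 (abs_nonneg _) (abs_le.mpr ?_)
    split_ifs <;> constructor <;> linarith

theorem routing_transpose_mulVec_none (w : Class L → ℝ) (i : Fin L) :
    ((routing θ)ᵀ *ᵥ w) (i, none) = 0 := by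
  simp [Matrix.mulVec, dotProduct, Fintype.sum_prod_type, Fintype.sum_option, routing]

theorem routing_transpose_mulVec_some (w : Class L → ℝ) (i j : Fin L) :
    ((routing θ)ᵀ *ᵥ w) (i, some j) = (if i - 1 = j then w (i - 1, none) else 0)
      + (1 - θ.q (i - 1) j) * w (i - 1, some j) := by
  have hi : ∀ i' : Fin L, i = i' + 1 ↔ i' = i - 1 := fun i' =>
    ⟨fun h => by rw [h, add_sub_cancel_right], fun h => by rw [h, sub_add_cancel]⟩
  simp only [Matrix.mulVec, dotProduct, Fintype.sum_prod_type, Fintype.sum_option,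
    Matrix.transpose_apply, routing, ite_mul, one_mul, zero_mul, hi, Option.some.injEq]
  rw [Finset.sum_eq_single (i - 1) (fun b _ hb => by simp [hb]) (by simp)]
  simp [eq_comm]

theorem queue_step (x : State L) (u : Class L → ℝ) (k : Class L) :
    (queue (step θ x u) k : ℝ) = queue x k + arrivalRate θ k
      - ((1 - (routing θ)ᵀ) *ᵥ work x) k + deviation θ k x u := by
  classical
  rw [Matrix.sub_mulVec, Matrix.one_mulVec, Pi.sub_apply]
  obtain ⟨i, _ | j⟩ := k
  · rw [routing_transpose_mulVec_none]
    simp only [queue, step, arrivalRate, work, deviation]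
    by_cases hs : ServesExternal x i
    · have := hs.1
      rw [if_pos hs, if_pos hs]
      push_cast [Nat.cast_sub (Nat.one_le_of_lt this)]
      ring
    · rw [if_neg hs, if_neg hs, Nat.sub_zero]
      push_cast
      ring
  · rw [routing_transpose_mulVec_some]
    simp only [queue, step, arrivalRate, work, deviation, transfer]
    push_cast
    by_cases hij : i - 1 = j <;> simp only [hij, true_and, false_and, if_true, if_false] <;>
      split_ifs <;> ring

theorem abs_queue_step_sub_le (x : State L) (u : Class L → ℝ) (k : Class L) :
    |(queue (step θ x u) k : ℝ) - queue x k| ≤ 1 := by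
  classical
  obtain ⟨i, _ | j⟩ := k
  · simp only [queue, step]
    by_cases hs : ServesExternal x i
    · have := hs.1
      rw [if_pos hs]
      push_cast [Nat.cast_sub (Nat.one_le_of_lt this)]
      rw [abs_le]
      split_ifs <;> constructor <;> linarith
    · rw [if_neg hs, Nat.sub_zero]
      push_cast
      rw [abs_le]
      split_ifs <;> constructor <;> linarith
  · have h1 : ((step θ x u i).2.1 j : ℝ) ≤ 1 := by exact_mod_cast ring_le_one _ i j
    have h2 : ((x i).2.1 j : ℝ) ≤ 1 := by exact_mod_cast ring_le_one _ i j
    have h3 : (0 : ℝ) ≤ (step θ x u i).2.1 j := Nat.cast_nonneg _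
    have h4 : (0 : ℝ) ≤ (x i).2.1 j := Nat.cast_nonneg _
    simp only [queue]
    rw [abs_le]
    constructor <;> linarith

theorem total_chain_le (x : State L) (t : ℕ) (ω : Ω L) :
    (total (chain θ x t ω) : ℝ) ≤ total x + Fintype.card (Class L) * t := by
  have h : ∀ k, (queue (chain θ x t ω) k : ℝ) ≤ queue x k + t := fun k => by
    have := abs_sub_le_of_abs_succ_sub_le (z := fun s => (queue (chain θ x s ω) k : ℝ))
      (fun s => abs_queue_step_sub_le θ _ _ k) 0 t
    simp only [Nat.cast_zero, sub_zero, Nat.abs_cast] at this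
    have h1 := (abs_le.mp this).2
    simp only [chain] at h1
    linarith
  rw [total, total]
  push_cast
  calc _ ≤ ∑ k, ((queue x k : ℝ) + t) := Finset.sum_le_sum fun k _ => h k
    _ = _ := by simp [Finset.sum_add_distrib]

theorem pathSum_succ (f : State L → (Class L → ℝ) → ℝ) (x : State L) (t : ℕ) (ω : Ω L) :
    pathSum θ f x (t + 1) ω = pathSum θ f x t ω + f (chain θ x t ω) (ω t) :=
  Finset.sum_range_succ _ _

/-- The cumulative work done on each class. -/
def cumWork (x : State L) (t : ℕ) (ω : Ω L) : Class L → ℝ := fun k =>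
  pathSum θ (fun x _ => work x k) x t ω

/-- The fluid balance equation before scaling; the sum of centred deviations is the only error term.
-/
theorem queue_chain (x : State L) (t : ℕ) (ω : Ω L) (k : Class L) :
    (queue (chain θ x t ω) k : ℝ) = queue x k + t * arrivalRate θ k
      - ((1 - (routing θ)ᵀ) *ᵥ cumWork θ x t ω) k + pathSum θ (deviation θ k) x t ω := by
  induction t with
  | zero =>
    have : cumWork θ x 0 ω = 0 := by funext k; simp [cumWork, pathSum]
    simp [this, pathSum, chain]
  | succ t ih =>
    have h : cumWork θ x (t + 1) ω = cumWork θ x t ω + work (chain θ x t ω) := by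
      funext k; exact pathSum_succ θ _ x t ω
    rw [chain, queue_step, ih, h, Matrix.mulVec_add, pathSum_succ, Pi.add_apply]
    push_cast
    ring

theorem sub_incidence_mulVec_cumWork (x : State L) (t : ℕ) (ω : Ω L) (i : Fin L) :
    (t : ℝ) - (incidence L *ᵥ cumWork θ x t ω) i
      = ∑ s ∈ Finset.range t, (1 - (incidence L *ᵥ work (chain θ x s ω)) i) := by
  induction t with
  | zero =>
    have : cumWork θ x 0 ω = 0 := by funext k; simp [cumWork, pathSum]
    simp [this]
  | succ t ih =>
    have h : cumWork θ x (t + 1) ω = cumWork θ x t ω + work (chain θ x t ω) := by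
      funext k; exact pathSum_succ θ _ x t ω
    rw [Finset.sum_range_succ, ← ih, h, Matrix.mulVec_add, Pi.add_apply]
    push_cast
    ring

end

/-! ### Fluid limits -/

/-- A monotone function that is locally constant on a neighbourhood of every point where `g ≠ 0`
has a Stieltjes measure that does not charge this set. -/
theorem ae_stieltjes_eq_zero {f : ℝ → ℝ} (hf : Monotone f) {g : ℝ → ℝ≥0∞}
    (h : ∀ t, g t ≠ 0 → ∃ r > 0, f (t + r) = f (t - r)) :
    ∀ᵐ t ∂hf.stieltjesFunction.measure, g t = 0 := by
  refine measure_null_of_locally_null _ fun t ht => ?_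
  obtain ⟨r, hr, hfr⟩ := h t ht
  refine ⟨Set.Ioc (t - r) (t + r / 2), mem_nhdsWithin_of_mem_nhds
    (Ioc_mem_nhds (by linarith) (by linarith)), ?_⟩
  rw [StieltjesFunction.measure_Ioc, ENNReal.ofReal_eq_zero, hf.stieltjesFunction_eq,
    hf.stieltjesFunction_eq]
  have h1 : Function.rightLim f (t + r / 2) ≤ f (t + r) := hf.rightLim_le (by linarith)
  have h2 : f (t - r) ≤ Function.rightLim f (t - r) := hf.le_rightLim le_rfl
  linarith

section

variable {L : ℕ} [NeZero L] {θ : Params L} {ω : Ω L} {x : ℕ → State L} {𝒰 : Ultrafilter ℕ}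
  {Q T : ℝ≥0 → Class L → ℝ}

theorem tendsto_idle (hx : Tendsto (fun n => (total (x n) : ℝ)) 𝒰 atTop)
    (hT : ∀ t k, Tendsto (fun n => scaled (total (x n)) (fun s => cumWork θ (x n) s ω k) t)
      𝒰 (𝓝 (T t k))) (t : ℝ≥0) (i : Fin L) :
    Tendsto (fun n => scaled (total (x n)) (fun s => ∑ r ∈ Finset.range s,
      (1 - (incidence L *ᵥ work (chain θ (x n) r ω)) i)) t) 𝒰 (𝓝 (idle T t i)) := by
  have hfl : Tendsto (fun n => (⌊(t : ℝ) * total (x n)⌋₊ : ℝ) / total (x n)) 𝒰 (𝓝 (t : ℝ)) :=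
    (tendsto_nat_floor_mul_div_atTop t.coe_nonneg).comp hx
  have h : Tendsto (fun n => (⌊(t : ℝ) * total (x n)⌋₊ : ℝ) / total (x n)
      - (incidence L *ᵥ fun k => scaled (total (x n)) (fun s => cumWork θ (x n) s ω k) t) i)
      𝒰 (𝓝 (t - (incidence L *ᵥ T t) i)) :=
    hfl.sub (tendsto_finsetSum _ fun k _ => (hT t k).const_mul _)
  refine h.congr fun n => ?_
  simp only [scaled, ← sub_incidence_mulVec_cumWork]
  rw [sub_div]
  simp only [Matrix.mulVec, dotProduct, Finset.sum_div, mul_div_assoc]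

theorem fluid_balance (hx : Tendsto (fun n => (total (x n) : ℝ)) 𝒰 atTop)
    (herr : ∀ k t, Tendsto (fun n => scaled (total (x n))
      (fun s => pathSum θ (deviation θ k) (x n) s ω) t) 𝒰 (𝓝 0))
    (hQ : ∀ t k, Tendsto (fun n => scaled (total (x n))
      (fun s => (queue (chain θ (x n) s ω) k : ℝ)) t) 𝒰 (𝓝 (Q t k)))
    (hT : ∀ t k, Tendsto (fun n => scaled (total (x n)) (fun s => cumWork θ (x n) s ω k) t)
      𝒰 (𝓝 (T t k))) (t : ℝ≥0) :
    Q t = Q 0 + (t : ℝ) • arrivalRate θ - (1 - (routing θ)ᵀ) *ᵥ T t := by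
  funext k
  have hfl : Tendsto (fun n => (⌊(t : ℝ) * total (x n)⌋₊ : ℝ) / total (x n)) 𝒰 (𝓝 (t : ℝ)) :=
    (tendsto_nat_floor_mul_div_atTop t.coe_nonneg).comp hx
  have h : Tendsto (fun n => scaled (total (x n))
        (fun s => (queue (chain θ (x n) s ω) k : ℝ)) 0
      + (⌊(t : ℝ) * total (x n)⌋₊ : ℝ) / total (x n) * arrivalRate θ k
      - ((1 - (routing θ)ᵀ) *ᵥ
        fun k => scaled (total (x n)) (fun s => cumWork θ (x n) s ω k) t) k
      + scaled (total (x n)) (fun s => pathSum θ (deviation θ k) (x n) s ω) t) 𝒰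
      (𝓝 (Q 0 k + t * arrivalRate θ k - ((1 - (routing θ)ᵀ) *ᵥ T t) k + 0)) :=
    (((hQ 0 k).add (hfl.mul_const _)).sub
      (tendsto_finsetSum _ fun k _ => (hT t k).const_mul _)).add (herr k t)
  rw [add_zero] at h
  refine tendsto_nhds_unique (hQ t k) (h.congr fun n => ?_)
  simp only [scaled, queue_chain, NNReal.coe_zero, zero_mul, Nat.floor_zero]
  have h0 : cumWork θ (x n) 0 ω = 0 := by funext k; simp [cumWork, pathSum]
  have h1 : pathSum θ (deviation θ k) (x n) 0 ω = 0 := by simp [pathSum]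
  rw [h0, h1]
  simp only [Matrix.mulVec, dotProduct, Pi.zero_apply, mul_zero, Finset.sum_const_zero,
    ← mul_div_assoc, ← Finset.sum_div]
  simp only [Nat.cast_zero, zero_mul]
  ring

/-- If the limiting queue is `c > 0` at `t`, the unscaled queue exceeds `3 * c / 4 * a` there. It
changes by at most one per step, so it stays positive for scaled times within `c / 4` of `t`, and
the station never idles. The bound `8 / c < a` absorbs the rounding. -/
theorem idle_locally_constant (hx : Tendsto (fun n => (total (x n) : ℝ)) 𝒰 atTop)
    (hQ : ∀ t k, Tendsto (fun n => scaled (total (x n))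
      (fun s => (queue (chain θ (x n) s ω) k : ℝ)) t) 𝒰 (𝓝 (Q t k)))
    (hT : ∀ t k, Tendsto (fun n => scaled (total (x n)) (fun s => cumWork θ (x n) s ω k) t)
      𝒰 (𝓝 (T t k))) {t : ℝ≥0} {i : Fin L} (ht : 0 < Q t (i, none)) :
    ∃ r > (0 : ℝ), ∀ s s' : ℝ≥0, s ≤ s' → (t : ℝ) - r ≤ s → (s' : ℝ) ≤ t + r →
      idle T s' i = idle T s i := by
  set c := Q t (i, none)
  refine ⟨c / 4, by positivity, fun s s' hss hs hs' => ?_⟩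
  refine tendsto_nhds_unique_of_eventuallyEq (tendsto_idle hx hT s' i) (tendsto_idle hx hT s i) ?_
  filter_upwards [(hQ t (i, none)).eventually_const_lt (show 3 * c / 4 < c by linarith),
    hx.eventually_gt_atTop (8 / c), hx.eventually_gt_atTop 0] with n hn hn1 hn0
  set a : ℝ := (total (x n) : ℝ)
  simp only [scaled] at hn ⊢
  congr 1
  refine (Finset.sum_subset (Finset.range_subset_range.mpr
    (Nat.floor_le_floor (by gcongr))) fun m hm hm' => ?_).symm
  refine (one_sub_incidence_mulVec_work _ i).2 ?_
  rw [Finset.mem_range] at hm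
  rw [Finset.mem_range, not_lt] at hm'
  have h1 : (m : ℝ) < s' * a := (Nat.cast_lt.mpr hm).trans_le
    (Nat.floor_le (mul_nonneg s'.coe_nonneg hn0.le))
  have h2 : (s : ℝ) * a < m + 1 := (Nat.lt_floor_add_one _).trans_le
    (by gcongr)
  have h3 := Nat.floor_le (mul_nonneg t.coe_nonneg hn0.le)
  have h4 := Nat.lt_floor_add_one ((t : ℝ) * a)
  have h5 : (s' : ℝ) * a ≤ (t + c / 4) * a := by gcongr
  have h6 : (t - c / 4) * a ≤ (s : ℝ) * a := by gcongr
  have h7 := abs_sub_le_of_abs_succ_sub_le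
    (z := fun s => (queue (chain θ (x n) s ω) (i, none) : ℝ))
    (fun s => abs_queue_step_sub_le θ _ _ _) ⌊(t : ℝ) * a⌋₊ m
  have h8 : |(m : ℝ) - ⌊(t : ℝ) * a⌋₊| ≤ c / 4 * a + 1 := abs_le.mpr
    ⟨by linarith, by linarith⟩
  have h9 := (abs_le.mp (h7.trans h8)).1
  rw [lt_div_iff₀ hn0] at hn
  rw [div_lt_iff₀ ht] at hn1
  have h10 : (0 : ℝ) < queue (chain θ (x n) m ω) (i, none) := by linarith
  exact_mod_cast h10

/-- The argument is pathwise, for a fixed `ω`. Convergence is tested along all ultrafilters finer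
than `atTop`; along each of them the limit is a fluid solution, to which stability applies. -/
theorem tendsto_total_of_fluidStable {δ : ℝ≥0}
    (hδ : ∀ Q T : ℝ≥0 → Class L → ℝ, IsFluidSolution θ Q T →
      ∑ k, |Q 0 k| = 1 → ∀ t, δ ≤ t → Q t = 0)
    (hx : Tendsto (fun n => (total (x n) : ℝ)) atTop atTop)
    (herr : ∀ k t, Tendsto (fun n => scaled (total (x n))
      (fun s => pathSum θ (deviation θ k) (x n) s ω) t) atTop (𝓝 0)) :
    Tendsto (fun n => scaled (total (x n)) (fun s => (total (chain θ (x n) s ω) : ℝ)) δ)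
      atTop (𝓝 0) := by
  rw [tendsto_iff_ultrafilter]
  intro 𝒰 h𝒰
  have hx := hx.mono_left h𝒰
  have hpos := hx.eventually_gt_atTop 0
  have herr := fun k t => (herr k t).mono_left h𝒰
  have hQ : ∀ k, ∃ Z : ℝ≥0 → ℝ, LipschitzWith 1 Z ∧ ∀ t, Tendsto (fun n => scaled (total (x n))
      (fun s => (queue (chain θ (x n) s ω) k : ℝ)) t) 𝒰 (𝓝 (Z t)) := fun k =>
    exists_lipschitz_limit 𝒰 hx (fun n s => abs_queue_step_sub_le θ _ _ k) fun n => by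
      rw [Nat.abs_cast]
      exact_mod_cast queue_le_total (x n) k
  have hT : ∀ k, ∃ Z : ℝ≥0 → ℝ, LipschitzWith 1 Z ∧ ∀ t, Tendsto (fun n => scaled (total (x n))
      (fun s => cumWork θ (x n) s ω k) t) 𝒰 (𝓝 (Z t)) := fun k =>
    exists_lipschitz_limit 𝒰 hx (fun n s => by
      rw [cumWork, cumWork, pathSum_succ, add_sub_cancel_left, abs_of_nonneg (work_nonneg _ _)]
      exact work_le_one _ _) fun n => by simp [cumWork, pathSum]
  choose Q' hQlip hQ using hQ
  choose T' hTlip hT using hT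
  set Q : ℝ≥0 → Class L → ℝ := fun t k => Q' k t
  set T : ℝ≥0 → Class L → ℝ := fun t k => T' k t
  have hQ : ∀ t k, Tendsto (fun n => scaled (total (x n))
      (fun s => (queue (chain θ (x n) s ω) k : ℝ)) t) 𝒰 (𝓝 (Q t k)) := fun t k => hQ k t
  have hT : ∀ t k, Tendsto (fun n => scaled (total (x n)) (fun s => cumWork θ (x n) s ω k) t)
      𝒰 (𝓝 (T t k)) := fun t k => hT k t
  have hmono : ∀ z : ℕ → ℕ → ℝ, (∀ n, Monotone (z n)) → ∀ s t : ℝ≥0, s ≤ t →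
      ∀ᶠ n in 𝒰, scaled (total (x n)) (z n) s ≤ scaled (total (x n)) (z n) t :=
    fun z hz s t hst => .of_forall fun n =>
      div_le_div_of_nonneg_right (hz n (Nat.floor_le_floor (by gcongr))) (Nat.cast_nonneg _)
  have hidle : Monotone (idle T) := fun s t hst i =>
    le_of_tendsto_of_tendsto (tendsto_idle hx hT s i) (tendsto_idle hx hT t i)
      (hmono _ (fun n => monotone_nat_of_le_succ fun s => by
        rw [Finset.sum_range_succ]
        exact le_add_of_nonneg_right (one_sub_incidence_mulVec_work _ i).1) s t hst)
  have hsol : IsFluidSolution θ Q T :=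
    { balance := fluid_balance hx herr hQ hT
      Q_nonneg := fun t k => ge_of_tendsto (hQ t k) (.of_forall fun n =>
        div_nonneg (Nat.cast_nonneg _) (Nat.cast_nonneg _))
      Q_lipschitz := hQlip
      T_mono := fun s t hst k => le_of_tendsto_of_tendsto (hT s k) (hT t k)
        (hmono _ (fun n => monotone_nat_of_le_succ fun s => by
          rw [cumWork, cumWork, pathSum_succ]
          exact le_add_of_nonneg_right (work_nonneg _ k)) s t hst)
      T_lipschitz := hTlip
      T_zero := by
        funext k
        refine tendsto_nhds_unique (hT 0 k) ?_
        simp [scaled, cumWork, pathSum]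
      idle_mono := hidle
      work_conserving := fun i => by
        refine (lintegral_congr_ae (ae_restrict_of_ae
          (ae_stieltjes_eq_zero (monotone_idleExt hidle i) fun t ht => ?_))).trans
          lintegral_zero
        obtain ⟨r, hr, h⟩ := idle_locally_constant hx hQ hT (t := t.toNNReal) (i := i)
          (by simpa using ht)
        refine ⟨r, hr, h _ _ (Real.toNNReal_mono (by linarith)) ?_ ?_⟩
        · simp only [Real.coe_toNNReal']
          rw [sub_le_iff_le_add]
          exact max_le (by linarith [le_max_left (t - r) 0]) (by linarith [le_max_right (t - r) 0])
        · simp only [Real.coe_toNNReal']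
          exact max_le (by linarith [le_max_left t 0]) (by linarith [le_max_right t 0])
      -- Ring queues never exceed one, so scaling sends them to zero.
      priority := fun t i j => by
        refine tendsto_nhds_unique (hQ t (i, some j)) (squeeze_zero
          (fun n => div_nonneg (Nat.cast_nonneg _) (Nat.cast_nonneg _)) (fun n => ?_)
          (tendsto_inv_atTop_zero.comp hx))
        rw [Function.comp_apply, inv_eq_one_div]
        exact div_le_div_of_nonneg_right (Nat.cast_le_one.mpr (ring_le_one _ i j))
          (Nat.cast_nonneg _) }
  -- The scale is the initial number of customers, so the norm is one already before the limit.
  have hnorm : ∑ k, |Q 0 k| = 1 := by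
    refine tendsto_nhds_unique (tendsto_finsetSum _ fun k _ => (hQ 0 k).abs)
      (tendsto_const_nhds.congr' ?_)
    filter_upwards [hpos] with n hn
    simp only [scaled, NNReal.coe_zero, zero_mul, Nat.floor_zero, chain, abs_div, Nat.abs_cast]
    rw [← Finset.sum_div, ← Nat.cast_sum]
    exact (div_self hn.ne').symm
  have hzero := hδ Q T hsol hnorm δ le_rfl
  have h := tendsto_finsetSum Finset.univ fun k _ => hQ δ k
  simp only [hzero, Pi.zero_apply, Finset.sum_const_zero] at h
  refine h.congr fun n => ?_
  simp only [scaled, total, ← Finset.sum_div, Nat.cast_sum]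

end

/-! ### Mean drift of the number of customers -/

theorem integral_stepLaw_comp_apply {L : ℕ} (k : Class L) {g : ℝ → ℝ} (hg : Measurable g) :
    ∫ u, g (u k) ∂(stepLaw L) = ∫ v, g v ∂unif := by
  have h := measurePreserving_eval (fun _ : Class L => unif) k
  rw [← h.map_eq, integral_map h.measurable.aemeasurable hg.aestronglyMeasurable]

theorem integral_unif_le {p : ℝ} (h0 : 0 ≤ p) (h1 : p < 1) :
    ∫ v, (if v ≤ p then (1 : ℝ) else 0) ∂unif = p := by
  have h : (fun v => if v ≤ p then (1 : ℝ) else 0) = (Set.Iic p).indicator 1 := by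
    funext v; simp [Set.indicator_apply]
  have h2 : Set.Iic p ∩ Set.Ioo 0 1 = Set.Ioc 0 p := by
    ext v
    simp only [Set.mem_inter_iff, Set.mem_Iic, Set.mem_Ioo, Set.mem_Ioc]
    constructor
    · rintro ⟨h, h', -⟩; exact ⟨h', h⟩
    · rintro ⟨h, h'⟩; exact ⟨h', h, h'.trans_lt h1⟩
  rw [h, integral_indicator_one measurableSet_Iic, Measure.real, unif,
    Measure.restrict_apply measurableSet_Iic, h2, Real.volume_Ioc, sub_zero,
    ENNReal.toReal_ofReal h0]

theorem integral_unif_lt {q : ℝ} (h0 : 0 ≤ q) (h1 : q ≤ 1) :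
    ∫ v, (if q < v then (1 : ℝ) else 0) ∂unif = 1 - q := by
  have h : (fun v => if q < v then (1 : ℝ) else 0) = (Set.Ioi q).indicator 1 := by
    funext v; simp [Set.indicator_apply]
  have h2 : Set.Ioi q ∩ Set.Ioo 0 1 = Set.Ioo q 1 := by
    ext v
    simp only [Set.mem_inter_iff, Set.mem_Ioi, Set.mem_Ioo]
    constructor
    · rintro ⟨h, -, h'⟩; exact ⟨h, h'⟩
    · rintro ⟨h, h'⟩; exact ⟨h, h0.trans_lt h, h'⟩
  rw [h, integral_indicator_one measurableSet_Ioi, Measure.real, unif,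
    Measure.restrict_apply measurableSet_Ioi, h2, Real.volume_Ioo,
    ENNReal.toReal_ofReal (by linarith)]

section

variable {L : ℕ} [NeZero L] (θ : Params L)

theorem measurable_deviation (k : Class L) (x : State L) : Measurable (deviation θ k x) := by
  obtain ⟨i, _ | j⟩ := k
  · exact (Measurable.ite (measurableSet_le (measurable_pi_apply _) measurable_const)
      measurable_const measurable_const).sub measurable_const
  · exact ((Measurable.ite (measurableSet_lt measurable_const (measurable_pi_apply _))
      measurable_const measurable_const).sub measurable_const).const_mul _

theorem integral_deviation (k : Class L) (x : State L) :
    ∫ u, deviation θ k x u ∂(stepLaw L) = 0 := by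
  obtain ⟨i, _ | j⟩ := k
  · have hm : Measurable fun v : ℝ => if v ≤ θ.p i then (1 : ℝ) else 0 :=
      Measurable.ite measurableSet_Iic measurable_const measurable_const
    simp only [deviation]
    rw [integral_sub _ (integrable_const _),
      integral_stepLaw_comp_apply (i, none) hm, integral_unif_le (θ.p_nonneg i) (θ.p_lt_one i)]
    · simp
    · exact .of_bound (C := 1) (hm.comp (measurable_pi_apply _)).aestronglyMeasurable
        (.of_forall fun u => by split_ifs <;> simp)
  · have hm : Measurable fun v : ℝ => if θ.q (i - 1) j < v then (1 : ℝ) else 0 :=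
      Measurable.ite measurableSet_Ioi measurable_const measurable_const
    simp only [deviation]
    rw [integral_const_mul, integral_sub _ (integrable_const _),
      integral_stepLaw_comp_apply (i - 1, some j) hm,
      integral_unif_lt (θ.q_nonneg _ _) (θ.q_le_one _ _)]
    · simp
    · exact .of_bound (C := 1) (hm.comp (measurable_pi_apply _)).aestronglyMeasurable
        (.of_forall fun u => by split_ifs <;> simp)

variable {θ}

/-- The second moment of the scaled sum is at most `t / total (x n) ≤ t * (1 / 2) ^ n`. These bounds
are summable, so the squares have an almost surely finite sum and tend to zero. -/
theorem ae_tendsto_scaled_deviation {x : ℕ → State L} (hx : ∀ n, 2 ^ n ≤ total (x n))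
    (k : Class L) (t : ℝ≥0) :
    ∀ᵐ ω ∂(noise L), Tendsto (fun n => scaled (total (x n))
      (fun s => pathSum θ (deviation θ k) (x n) s ω) t) atTop (𝓝 0) := by
  set M : ℕ → Ω L → ℝ := fun n ω =>
    scaled (total (x n)) (fun s => pathSum θ (deviation θ k) (x n) s ω) t
  have hM : ∀ n, Measurable (M n) := fun n =>
    (measurable_pathSum (measurable_deviation θ k) (x n) _).div_const _
  have hpos : ∀ n, (0 : ℝ) < total (x n) := fun n =>
    Nat.cast_pos.mpr ((pow_pos two_pos n).trans_le (hx n))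
  have hsq : ∀ n, ∫⁻ ω, ENNReal.ofReal (M n ω ^ 2) ∂(noise L)
      ≤ ENNReal.ofReal (t * (1 / 2) ^ n) := fun n => by
    have hb : ∀ ω, |M n ω ^ 2|
        ≤ ((⌊(t : ℝ) * total (x n)⌋₊ : ℝ) / total (x n)) ^ 2 := fun ω => by
      rw [abs_pow]
      refine pow_le_pow_left₀ (abs_nonneg _) ?_ 2
      simp only [M, scaled, abs_div, Nat.abs_cast]
      gcongr
      exact abs_pathSum_le (abs_deviation_le θ k) _ _ _
    rw [← ofReal_integral_eq_lintegral_ofReal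
      (.of_bound (C := _) ((hM n).pow_const 2).aestronglyMeasurable (.of_forall hb))
      (.of_forall fun ω => sq_nonneg _)]
    refine ENNReal.ofReal_le_ofReal ?_
    have h1 : (1 : ℝ) ≤ (1 / 2) ^ n * total (x n) := by
      have : (2 : ℝ) ^ n ≤ total (x n) := by exact_mod_cast hx n
      rw [one_div, inv_pow, inv_mul_eq_div]
      exact (one_le_div (by positivity)).mpr this
    generalize ((1 : ℝ) / 2) ^ n = c at h1 ⊢
    simp only [M, scaled, div_pow]
    rw [integral_div, div_le_iff₀ (pow_pos (hpos n) 2)]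
    refine (integral_pathSum_sq_le (measurable_deviation θ k) (abs_deviation_le θ k)
      (integral_deviation θ k) (x n) _).trans
        ((Nat.floor_le (mul_nonneg t.coe_nonneg (hpos n).le)).trans ?_)
    calc (t : ℝ) * total (x n) = t * total (x n) * 1 := (mul_one _).symm
      _ ≤ t * total (x n) * (c * total (x n)) := by gcongr
      _ = _ := by ring
  have hsum : ∫⁻ ω, ∑' n, ENNReal.ofReal (M n ω ^ 2) ∂(noise L) ≠ ∞ := by
    rw [lintegral_tsum fun n => ((hM n).pow_const 2).ennreal_ofReal.aemeasurable]
    refine ne_top_of_le_ne_top ?_ (ENNReal.tsum_le_tsum hsq)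
    rw [← ENNReal.ofReal_tsum_of_nonneg (fun n => by positivity)
      ((summable_geometric_two).mul_left _)]
    exact ENNReal.ofReal_ne_top
  filter_upwards [ae_lt_top (Measurable.tsum fun n =>
    ((hM n).pow_const 2).ennreal_ofReal) hsum] with ω hω
  have h1 := ENNReal.tendsto_atTop_zero_of_tsum_ne_top hω.ne
  have h2 := (ENNReal.tendsto_toReal ENNReal.zero_ne_top).comp h1
  have h3 : Tendsto (fun n => M n ω ^ 2) atTop (𝓝 0) :=
    h2.congr fun n => ENNReal.toReal_ofReal (sq_nonneg _)
  have h4 := (Real.continuous_sqrt.tendsto 0).comp h3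
  rw [Real.sqrt_zero] at h4
  exact tendsto_zero_iff_abs_tendsto_zero _ |>.mpr (h4.congr fun n => Real.sqrt_sq_eq_abs _)

theorem measurable_total_chain (x : State L) (t : ℕ) :
    Measurable fun ω => (total (chain θ x t ω) : ℝ) :=
  (measurable_of_countable fun z : State L => (total z : ℝ)).comp (measurable_chain θ x t)

theorem integrable_total_chain (x : State L) (t : ℕ) :
    Integrable (fun ω => (total (chain θ x t ω) : ℝ)) (noise L) :=
  .of_bound (C := _) (measurable_total_chain x t).aestronglyMeasurable (.of_forall fun ω => by
    rw [Real.norm_eq_abs, Nat.abs_cast]; exact total_chain_le θ x t ω)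

/-- Otherwise there are counterexamples with at least `2 ^ n` customers for every `n`. Their scaled
totals at time `δ` tend to zero almost surely and are bounded by a constant, so their means tend to
zero, contradicting the lower bound `1 / 2`. -/
theorem exists_forall_integral_total_le {δ : ℝ≥0}
    (hδ : ∀ Q T : ℝ≥0 → Class L → ℝ, IsFluidSolution θ Q T →
      ∑ k, |Q 0 k| = 1 → ∀ t, δ ≤ t → Q t = 0) :
    ∃ κ : ℕ, ∀ x : State L, κ ≤ total x →
      ∫ ω, (total (chain θ x ⌊(δ : ℝ) * total x⌋₊ ω) : ℝ) ∂(noise L) ≤ total x / 2 := by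
  by_contra! h
  choose y hy hyI using h
  set x : ℕ → State L := fun n => y (2 ^ n)
  have hx : ∀ n, 2 ^ n ≤ total (x n) := fun n => hy (2 ^ n)
  have hpos : ∀ n, (0 : ℝ) < total (x n) := fun n =>
    Nat.cast_pos.mpr ((pow_pos two_pos n).trans_le (hx n))
  have hxt : Tendsto (fun n => (total (x n) : ℝ)) atTop atTop :=
    tendsto_natCast_atTop_atTop.comp
      (tendsto_atTop_mono hx (tendsto_pow_atTop_atTop_of_one_lt one_lt_two))
  have hae : ∀ᵐ ω ∂(noise L), Tendsto (fun n => scaled (total (x n))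
      (fun s => (total (chain θ (x n) s ω) : ℝ)) δ) atTop (𝓝 0) := by
    have h1 : ∀ᵐ ω ∂(noise L), ∀ (m : ℕ) (k : Class L), Tendsto (fun n => scaled (total (x n))
        (fun s => pathSum θ (deviation θ k) (x n) s ω) (TopologicalSpace.denseSeq ℝ≥0 m))
        atTop (𝓝 0) :=
      ae_all_iff.mpr fun m => ae_all_iff.mpr fun k => ae_tendsto_scaled_deviation hx k _
    filter_upwards [h1] with ω hω
    refine tendsto_total_of_fluidStable hδ hxt fun k t => ?_
    refine tendsto_scaled_zero_of_dense hxt (fun n s => ?_)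
      (TopologicalSpace.denseRange_denseSeq ℝ≥0) (Set.forall_mem_range.mpr fun m => hω m k) t
    rw [pathSum_succ, add_sub_cancel_left]
    exact abs_deviation_le θ k _ _
  have hlim := tendsto_integral_of_dominated_convergence
    (fun _ => 1 + Fintype.card (Class L) * (δ : ℝ))
    (fun n => ((measurable_total_chain (θ := θ) (x n) ⌊(δ : ℝ) * total (x n)⌋₊).div_const
      (total (x n) : ℝ)).aestronglyMeasurable) (integrable_const _)
    (fun n => .of_forall fun ω => by
      rw [Real.norm_eq_abs, abs_div, Nat.abs_cast, Nat.abs_cast, div_le_iff₀ (hpos n)]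
      refine (total_chain_le θ _ _ ω).trans ?_
      have := Nat.floor_le (mul_nonneg δ.coe_nonneg (hpos n).le)
      calc _ ≤ (total (x n) : ℝ) + Fintype.card (Class L) * (δ * total (x n)) := by gcongr
        _ = _ := by ring) hae
  rw [integral_zero] at hlim
  obtain ⟨n, hn⟩ := (hlim.eventually_lt_const (show (0 : ℝ) < 1 / 2 by norm_num)).exists
  rw [integral_div, div_lt_iff₀ (hpos n)] at hn
  have := hyI (2 ^ n)
  simp only [x] at hn
  linarith

theorem finite_setOf_total_lt (L κ : ℕ) : {x : State L | total x < κ}.Finite := by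
  have hinj : Function.Injective (queue (L := L)) := fun x y h => by
    funext i
    exact Prod.ext (congrFun h (i, none)) (Subtype.ext (funext fun j => congrFun h (i, some j)))
  refine ((Set.finite_Icc (0 : Class L → ℕ) fun _ => κ).preimage hinj.injOn).subset fun x hx => ?_
  exact ⟨fun k => Nat.zero_le _, fun k => (queue_le_total x k).trans (le_of_lt hx)⟩

end

end RingNetwork

end

/-- If the fluid model is stable, then the Markov chain of the multiclass network is positive
recurrent. -/
theorem mainTheorem4 (L : ℕ) [NeZero L] (θ : RingNetwork.Params L)
    (hstable : RingNetwork.FluidStable θ) : RingNetwork.PositiveRecurrent θ := by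
  open RingNetwork in
  obtain ⟨δ, -, hδ⟩ := hstable
  obtain ⟨κ, hκ⟩ := exists_forall_integral_total_le hδ
  intro x y hy
  -- With the factor `2 * δ + 4`, halving the total gains `(δ + 2) * total x`, which pays for at
  -- most `δ * total x` steps and the extra unit once `total x ≥ 1`; hence `max κ 1` below.
  have hC : (0 : ℝ) ≤ 2 * δ + 4 := by positivity
  have hV : ∀ x m, ∫⁻ ω, ENNReal.ofReal ((2 * δ + 4) * total (chain θ x m ω)) ∂(noise L)
      = ENNReal.ofReal ((2 * δ + 4) * ∫ ω, (total (chain θ x m ω) : ℝ) ∂(noise L)) := fun x m => by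
    rw [← integral_const_mul, ofReal_integral_eq_lintegral_ofReal
      ((integrable_total_chain x m).const_mul _)
      (.of_forall fun ω => mul_nonneg hC (Nat.cast_nonneg _))]
  refine lintegral_returnTime_lt_top_of_drift
    (V := fun x => ENNReal.ofReal ((2 * δ + 4) * total x)) (fun x m => ?_)
    (finite_setOf_total_lt L (max κ 1)) (n := fun x => ⌊(δ : ℝ) * total x⌋₊) (fun x hx => ?_)
    (fun x _ => exists_noise_chain_pos hy x) x
  · rw [hV]
    exact ENNReal.ofReal_ne_top
  · rw [Set.mem_ofPred_eq, not_lt, max_le_iff] at hx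
    obtain ⟨hx1, hx2⟩ := hx
    have h1 : (1 : ℝ) ≤ total x := by exact_mod_cast hx2
    have h2 := mul_le_mul_of_nonneg_left (hκ x hx1) hC
    have h3 := Nat.floor_le (mul_nonneg δ.coe_nonneg (zero_le_one.trans h1))
    have h4 : 0 ≤ (2 * (δ : ℝ) + 4)
        * ∫ ω, (total (chain θ x ⌊(δ : ℝ) * total x⌋₊ ω) : ℝ) ∂(noise L) :=
      mul_nonneg hC (integral_nonneg fun ω => Nat.cast_nonneg _)
    rw [hV, ← ENNReal.ofReal_natCast, ← ENNReal.ofReal_one,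
      ← ENNReal.ofReal_add h4 (Nat.cast_nonneg _),
      ← ENNReal.ofReal_add (add_nonneg h4 (Nat.cast_nonneg _)) zero_le_one]
    refine ENNReal.ofReal_le_ofReal ?_
    have h5 : (2 * (δ : ℝ) + 4) * (total x / 2) = δ * total x + 2 * total x := by ring
    have h6 : (2 * (δ : ℝ) + 4) * total x = 2 * (δ * total x) + 4 * total x := by ring
    have h7 : 0 ≤ (δ : ℝ) * total x := mul_nonneg δ.coe_nonneg (Nat.cast_nonneg _)
    linarith
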